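/- **Conventions.** Computability is Kleene's S1–S9 computability for total functionals of pure finite type. $\exists^2:\mathbb N^{\mathbb N}\to\{0,1\}$ is Kleene's quantifier: $\exists^2(g)=0$ if and only if $g(n)=0$ for some $n$. A real $x$ is coded by any sequence of (numbers of) rationals $(q_n)_{n\in\mathbb N}$ with $|q_n-x|\le 2^{-n}$ for all $n$. A function $f:[0,1]\to\mathbb R$ is coded by any total type 2 functional (a map $\mathbb N^{\mathbb N}\times\mathbb N\to\mathbb N$, regarded as a map $\mathbb N^{\mathbb N}\to\mathbb N$) that sends each code of each $x\in[0,1]$ to a code of $f(x)$. A functional $\Phi$ that sends functions $f$ to reals, or to maps $\mathbb R^m\to\mathbb R$, is *computable in $\exists^2$ on a class $\mathcal C$* of functions if there is one S1–S9 index that, for all $f\in\mathcal C$ and all real parameters, computes a code of the value from $\exists^2$, any code of $f$ and any codes of the parameters. For functionals that send $f$ to a map $\mathbb R\times\mathbb N\to\mathbb N$, the value itself is computed. Write $BV$ for the set of functions $f:[0,1]\to\mathbb R$ of bounded variation, and $f(x-)$, $f(x+)$ for the left and right limits. A function is *quasi-continuous* if for all $x_0\in[0,1]$, all $\varepsilon>0$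 and every open neighbourhood $U$ of $x_0$ in $[0,1]$ there is a non-empty open $G\subseteq U$ with $|f(x_0)-f(x)|<\varepsilon$ for all $x\in G$. **Theorem.** Let $\mathcal C$ be one of the following classes: * the *normalised* functions $f\in BV$, i.e. $f(0)=0$ and $f(x+)=f(x)$ for all $x\in[0,1)$; * the quasi-continuous functions $f\in BV$; * the $f\in BV$ with $\min(f(x-),f(x+))\le f(x)\le\max(f(x-),f(x+))$ for all $x\in(0,1)$; * the $f\in BV$ with $f(x)=\frac{f(x+)+f(x-)}2$ for all $x\in(0,1)$. Then there are functionals as follows, each of them computable in $\exists^2$ on $\mathcal C$ (in item (e): on the set of $f\in\mathcal C$ that satisfy the hypotheses stated there). * (a) $\Phi$ such that $\Phi(f,p,q)=\sup_{x\in[p,q]}f(x)$ for all $f\in\mathcal C$ and $0\le p\le q\le1$. * (b) $\Psi$ such that for all $f\in\mathcal C$, $\Psi(f)=(g,h)$ where $f=g-h$ on $[0,1]$ and $g,h$ are non-decreasing on $[0,1]$. * (c) $\Xi$ such that for all $f\in\mathcal C$, $\Xi(f)\in[0,1]$ and $f$ is continuous at $\Xi(f)$. * (d) $\kappa$ such that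 for all $f\in\mathcal C$, $\kappa(f)\in[0,1]$ and the symmetric partial sums of the Fourier series of $f$ on $[0,1]$ converge to $f(\kappa(f))$ at $\kappa(f)$. * (e) $\zeta$ such that for all $f\in\mathcal C$ with $f\ge0$ on $[0,1]$ and $\int_0^1f(x)\,dx=0$, $\zeta(f)\in[0,1]$ and $f(\zeta(f))=0$. If $\mathcal C$ is the class of normalised functions, then there is also such a $\zeta$ without the hypothesis $f\ge0$. * (f) $\varepsilon$ such that for all $f\in\mathcal C$, $\varepsilon(f)\in(0,1)$ and $F(x)=\int_0^xf(t)\,dt$ is differentiable at $\varepsilon(f)$ with $F'(\varepsilon(f))=f(\varepsilon(f))$. * (g) $M$ such that for all $f\in\mathcal C$, $M(f):\mathbb R\times\mathbb N\to\mathbb N$ is a modulus of continuity: for all $k\in\mathbb N$, all points $x\in[0,1]$ of continuity of $f$ and all $y\in[0,1]$, $|x-y|<2^{-M(f)(x,k)}$ implies $|f(x)-f(y)|<2^{-k}$. * (h) $\delta$ such that for all $f\in\mathcal C$, $\delta(f):\mathbb R\times\mathbb N\to\mathbb N$ is a modulus of regulation: for all $k\in\mathbb N$ and $x\in[0,1]$,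 with $r=2^{-(\delta(f)(x,k)+1)}$, we have $|f(x+)-f(y)|<2^{-k}$ for all $y\in(x,x+r)\cap[0,1]$ and $|f(x-)-f(z)|<2^{-k}$ for all $z\in(x-r,x)\cap[0,1]$. -/

import Mathlib

open Set Filter Topology

namespace Kleene

/-! ## Kleene's S1-S9 computability over the total functionals of pure finite type -/

/-- The pure types: `Tp 0 = ℕ` and `Tp (n + 1) = (Tp n → ℕ)`, all functionals being total. -/
def Tp : ℕ → Type
  | 0 => ℕ
  | n + 1 => Tp n → ℕ

/-- An argument of a computation: an object of some pure type. -/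
abbrev Arg : Type := Σ n : ℕ, Tp n

/-- A number as an argument of type 0. -/
abbrev arg0 (a : ℕ) : Arg := ⟨0, a⟩

/-- An element of Baire space as an argument of type 1. -/
abbrev arg1 (α : ℕ → ℕ) : Arg := ⟨1, α⟩

/-- A functional on Baire space as an argument of type 2. -/
abbrev arg2 (Y : (ℕ → ℕ) → ℕ) : Arg := ⟨2, Y⟩

/-- `Computes e args y` is Kleene's relation `{e}(args) ≃ y`, generated by the schemes S1-S9.
An index is a natural number that codes the number of the scheme and its parameters; since
an index is a number, it may occur as an argument, which is what S9 exploits. -/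
inductive Computes : ℕ → List Arg → ℕ → Prop
  /-- Successor: `φ(a, b) = a + 1`. -/
  | S1 (a : ℕ) (b : List Arg) : Computes (Nat.pair 1 0) (arg0 a :: b) (a + 1)
  /-- Constants: `φ(b) = q`. -/
  | S2 (q : ℕ) (b : List Arg) : Computes (Nat.pair 2 q) b q
  /-- Identity: `φ(a, b) = a`. -/
  | S3 (a : ℕ) (b : List Arg) : Computes (Nat.pair 3 0) (arg0 a :: b) a
  /-- Composition: `φ(b) = ψ(χ(b), b)`. -/
  | S4 (g h : ℕ) (b : List Arg) (x y : ℕ) :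
      Computes h b x → Computes g (arg0 x :: b) y →
      Computes (Nat.pair 4 (Nat.pair g h)) b y
  /-- Primitive recursion, base: `φ(0, b) = ψ(b)`. -/
  | S5_zero (g h : ℕ) (b : List Arg) (y : ℕ) :
      Computes g b y → Computes (Nat.pair 5 (Nat.pair g h)) (arg0 0 :: b) y
  /-- Primitive recursion, step: `φ(a + 1, b) = χ(a, φ(a, b), b)`. -/
  | S5_succ (g h a : ℕ) (b : List Arg) (x y : ℕ) :
      Computes (Nat.pair 5 (Nat.pair g h)) (arg0 a :: b) x →
      Computes h (arg0 a :: arg0 x :: b) y →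
      Computes (Nat.pair 5 (Nat.pair g h)) (arg0 (a + 1) :: b) y
  /-- Permutation of the arguments: the argument in the given position is moved to the front. -/
  | S6 (g : ℕ) (a : List Arg) (x : Arg) (c : List Arg) (y : ℕ) :
      Computes g (x :: (a ++ c)) y →
      Computes (Nat.pair 6 (Nat.pair a.length g)) (a ++ x :: c) y
  /-- Application of a type 1 argument: `φ(α, a, b) = α(a)`. -/
  | S7 (α : ℕ → ℕ) (a : ℕ) (b : List Arg) :
      Computes (Nat.pair 7 0) (arg1 α :: arg0 a :: b) (α a)
  /-- Application of an argument of type `j + 2`: `φ(α, b) = α(λ τ. χ(α, τ, b))`, which is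
  defined only if `χ(α, τ, b)` is defined for all `τ` of type `j`. -/
  | S8 (j h : ℕ) (α : Tp (j + 2)) (b : List Arg) (v : Tp j → ℕ) :
      (∀ τ : Tp j, Computes h (⟨j + 2, α⟩ :: ⟨j, τ⟩ :: b) (v τ)) →
      Computes (Nat.pair 8 (Nat.pair j h)) (⟨j + 2, α⟩ :: b) (α v)
  /-- Index invocation: `φ(a, b, c) = {a}(b)`. -/
  | S9 (a : ℕ) (b c : List Arg) (y : ℕ) :
      Computes a b y → Computes (Nat.pair 9 b.length) (arg0 a :: (b ++ c)) y

open Classical in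
/-- Kleene's quantifier `∃²`: it maps `f` to `0` if `f` has a zero, and to `1` otherwise. -/
noncomputable def E2 : (ℕ → ℕ) → ℕ := fun f => if ∃ n, f n = 0 then 0 else 1

/-! ## Real numbers and functions on the unit interval as objects of finite type -/

/-- The rational number coded by a natural number: `⟨a, ⟨b, c⟩⟩` codes `(a - b) / (c + 1)`. -/
def ratOf (n : ℕ) : ℚ :=
  (((Nat.unpair n).1 : ℚ) - ((Nat.unpair (Nat.unpair n).2).1 : ℚ)) /
    (((Nat.unpair (Nat.unpair n).2).2 : ℚ) + 1)

/-- `α` codes the real `x` as a fast converging sequence of rationals. -/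
def RealName (α : ℕ → ℕ) (x : ℝ) : Prop :=
  ∀ n, |(ratOf (α n) : ℝ) - x| ≤ (1 / 2 : ℝ) ^ n

/-- The sequence `n, α 0, α 1, …`. -/
def prepend (n : ℕ) (α : ℕ → ℕ) : ℕ → ℕ
  | 0 => n
  | k + 1 => α k

/-- The (total) type 2 functional `Y` codes the restriction of `f` to `[0, 1]`: it sends each
code `α` of a point `x ∈ [0, 1]` to a code of `f x`, where the map `(α, n) ↦ Y (n, α 0, α 1, …)`
of type `ℕ^ℕ × ℕ → ℕ` is identified with a map `ℕ^ℕ → ℕ^ℕ`. No computability or continuity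
of `Y` is assumed, and `Y` is arbitrary on sequences that code no real in `[0, 1]`. -/
def FunName (Y : (ℕ → ℕ) → ℕ) (f : ℝ → ℝ) : Prop :=
  ∀ x ∈ Icc (0 : ℝ) 1, ∀ α, RealName α x → RealName (fun n => Y (prepend n α)) (f x)

/-- The functional `Φ`, with values in `ℝ` and with `m` real parameters, restricted to the class
`C` of functions on `[0, 1]`, is S1-S9 computable in `∃²`: there is one index that produces a
code of `Φ f x` from `∃²`, any code of `f ∈ C`, and any codes of the reals `x i`. -/
def RealComputableInE2 (C : Set (ℝ → ℝ)) (m : ℕ) (Φ : (ℝ → ℝ) → (Fin m → ℝ) → ℝ) : Prop :=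
  ∃ e : ℕ, ∀ f ∈ C, ∀ Y, FunName Y f →
    ∀ (x : Fin m → ℝ) (α : Fin m → ℕ → ℕ), (∀ i, RealName (α i) (x i)) →
      ∃ β : ℕ → ℕ, RealName β (Φ f x) ∧
        ∀ n, Computes e (arg2 E2 :: arg2 Y :: (List.ofFn (fun i => arg1 (α i)) ++ [arg0 n])) (β n)

/-- The functional `M`, which sends a function to a map `ℝ × ℕ → ℕ`, restricted to the class `C`
of functions on `[0, 1]`, is S1-S9 computable in `∃²`. -/
def ModulusComputableInE2 (C : Set (ℝ → ℝ)) (M : (ℝ → ℝ) → ℝ → ℕ → ℕ) : Prop :=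
  ∃ e : ℕ, ∀ f ∈ C, ∀ Y, FunName Y f →
    ∀ (x : ℝ) (α : ℕ → ℕ), RealName α x →
      ∀ k, Computes e [arg2 E2, arg2 Y, arg1 α, arg0 k] (M f x k)

/-! ## The function classes

A function `[0, 1] → ℝ` is given as a function `f : ℝ → ℝ` of which only the values on `[0, 1]`
matter. A function of bounded variation has all one-sided limits, so that
`Function.leftLim f x` is `f(x-)` for `x ∈ (0, 1]` and `Function.rightLim f x` is `f(x+)`
for `x ∈ [0, 1)`. -/

/-- Functions of bounded variation on `[0, 1]`. -/
def BV : Set (ℝ → ℝ) := {f | BoundedVariationOn f (Icc 0 1)}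

/-- Normalised functions of bounded variation: `f 0 = 0` and `f(x+) = f(x)` on `[0, 1)`. -/
def NormalisedBV : Set (ℝ → ℝ) :=
  {f | f ∈ BV ∧ f 0 = 0 ∧ ∀ x ∈ Ico (0 : ℝ) 1, Tendsto f (𝓝[>] x) (𝓝 (f x))}

/-- `f` is quasi-continuous on the space `[0, 1]`. -/
def QuasiContinuous (f : ℝ → ℝ) : Prop :=
  ∀ x₀ ∈ Icc (0 : ℝ) 1, ∀ ε > 0, ∀ U : Set ℝ, IsOpen U → x₀ ∈ U →
    ∃ G : Set ℝ, IsOpen G ∧ G ⊆ U ∧ (G ∩ Icc 0 1).Nonempty ∧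
      ∀ x ∈ G ∩ Icc 0 1, |f x₀ - f x| < ε

/-- Quasi-continuous functions of bounded variation. -/
def QuasiContinuousBV : Set (ℝ → ℝ) := {f | f ∈ BV ∧ QuasiContinuous f}

/-- Functions of bounded variation whose values lie between the one-sided limits. -/
def IntermediateBV : Set (ℝ → ℝ) :=
  {f | f ∈ BV ∧ ∀ x ∈ Ioo (0 : ℝ) 1,
    min (Function.leftLim f x) (Function.rightLim f x) ≤ f x ∧
      f x ≤ max (Function.leftLim f x) (Function.rightLim f x)}

/-- Functions of bounded variation whose values are the midpoints of the one-sided limits. -/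
def MidpointBV : Set (ℝ → ℝ) :=
  {f | f ∈ BV ∧ ∀ x ∈ Ioo (0 : ℝ) 1,
    f x = (Function.rightLim f x + Function.leftLim f x) / 2}

/-! ## Notions from analysis -/

/-- `x` is a point of `[0, 1]` at which `f : [0, 1] → ℝ` is continuous. -/
def ContinuityPoint (f : ℝ → ℝ) (x : ℝ) : Prop :=
  x ∈ Icc (0 : ℝ) 1 ∧ ContinuousWithinAt f (Icc 0 1) x

/-- The `N`-th symmetric partial sum at `x` of the Fourier series of `f` on `[0, 1]`. -/
noncomputable def fourierPartialSum (f : ℝ → ℝ) (N : ℕ) (x : ℝ) : ℂ :=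
  ∑ n ∈ Finset.Icc (-(N : ℤ)) (N : ℤ),
    fourierCoeffOn (zero_lt_one' ℝ) (fun t => (f t : ℂ)) n *
      Complex.exp (2 * Real.pi * Complex.I * n * x)

/-- `M` is a modulus of continuity for `f : [0, 1] → ℝ`. -/
def IsModulusOfContinuity (f : ℝ → ℝ) (M : ℝ → ℕ → ℕ) : Prop :=
  ∀ k x, ContinuityPoint f x → ∀ y ∈ Icc (0 : ℝ) 1,
    |x - y| < (1 / 2 : ℝ) ^ M x k → |f x - f y| < (1 / 2 : ℝ) ^ k

/-- `M` is a modulus of regulation for `f : [0, 1] → ℝ`: a modulus of convergence for the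
right limits (at the points of `[0, 1)`) and for the left limits (at the points of `(0, 1]`). -/
def IsModulusOfRegulation (f : ℝ → ℝ) (M : ℝ → ℕ → ℕ) : Prop :=
  ∀ k, ∀ x ∈ Icc (0 : ℝ) 1,
    (∀ y ∈ Ioo x (x + (1 / 2 : ℝ) ^ (M x k + 1)) ∩ Icc 0 1,
      |Function.rightLim f x - f y| < (1 / 2 : ℝ) ^ k) ∧
    (∀ z ∈ Ioo (x - (1 / 2 : ℝ) ^ (M x k + 1)) x ∩ Icc 0 1,
      |Function.leftLim f x - f z| < (1 / 2 : ℝ) ^ k)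

end Kleene

/-! Each of the four classes lies in `IntermediateBV`, the functions of bounded variation whose
values at interior points lie between the one-sided limits. For a quasi-continuous function this
holds because a value away from both limits would be isolated (`quasiContinuousBV_subset`). For such
functions, a closed order-connected set that contains the values at the dyadic points of an open
interval contains all values there (`mem_of_forall_dyadicPoint`). Quantifiers over reals thus become
quantifiers over numbers, which ∃² decides. This settles suprema and both moduli.

Let V(x) be the supremum over N of the variation of f on [0, x] along the grid of step 2^(-N), cut
off at x. Because f(x) lies between its one-sided limits, a fine grid loses almost nothing by
stepping over x, so |f(y) - f(x)| ≤ V(y) - V(x) for x ≤ y (`abs_sub_le_variation_sub`). Hence V and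
V - f are non-decreasing, which is the Jordan decomposition, and f is integrable.

All the special points are one point. Starting from [0, 1], pass repeatedly to the one of the two
middle quarters on which V increases less. The length is divided by 4 and the increase of V at least
halved, so at the common point x one has |f(y) - f(x)| ≤ C √|y - x| (`abs_sub_regularPoint_le`).
This gives continuity, the derivative of the integral, and a zero if f ≥ 0 has integral zero. It is
also Dini's condition for convergence of the Fourier series, as (f(t) - f(x)) / (e(x - t) - 1), with
e = `expUnit`, is integrable (`tendsto_fourierPartialSum`).

On the side of computability, `Cp` is computability of number functions uniformly in a list of
functional arguments, derived from S1-S9. A real is handled through its left cut (`CR`), which does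
not depend on a code, so the functionals depend on f alone. With ∃², cuts and codes can be converted
into each other, the order of reals is decidable, and suprema of bounded sequences are computable.
-/

namespace Kleene

/-! ## Rearranging the arguments of a computation -/

/-- Computations on the arguments `w x` can be carried out, uniformly in `x`, on the
arguments `u x`. -/
def Red {X : Type*} (u w : X → List Arg) : Prop :=
  ∀ e, ∃ e', ∀ x v, Computes e (w x) v → Computes e' (u x) v

section Red

variable {X : Type*}

theorem Red.refl (u : X → List Arg) : Red u u := fun e => ⟨e, fun _ _ h => h⟩

theorem Red.trans {u v w : X → List Arg} (h₁ : Red u v) (h₂ : Red v w) : Red u w := fun e => by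
  obtain ⟨e₂, he₂⟩ := h₂ e
  obtain ⟨e₁, he₁⟩ := h₁ e₂
  exact ⟨e₁, fun x y h => he₁ x y (he₂ x y h)⟩

/-- This is S6. The position is part of the index, so `p x` must have the same length for all `x`.
-/
theorem Red.front {p c : X → List Arg} {z : X → Arg} {L : ℕ} (hp : ∀ x, (p x).length = L) :
    Red (fun x => p x ++ z x :: c x) (fun x => z x :: (p x ++ c x)) := fun e =>
  ⟨Nat.pair 6 (Nat.pair L e), fun x v h => by
    rw [← hp x]; exact Computes.S6 e (p x) (z x) (c x) v h⟩

/-- A block of arguments can be moved to the front. -/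
theorem Red.block (K : ℕ) {p s c : X → List Arg} {L : ℕ} (hp : ∀ x, (p x).length = L)
    (hs : ∀ x, (s x).length = K) :
    Red (fun x => p x ++ s x ++ c x) (fun x => s x ++ p x ++ c x) := by
  induction K generalizing p s L with
  | zero =>
    have : ∀ x, s x = [] := fun x => List.length_eq_zero_iff.1 (hs x)
    simpa [this] using Red.refl _
  | succ K ih =>
    have hne : ∀ x, s x ≠ [] := fun x h => by simpa [h] using hs x
    have hsd : ∀ x, (s x).dropLast ++ [(s x).getLast (hne x)] = s x :=
      fun x => List.dropLast_append_getLast (hne x)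
    -- The last entry of the block goes to the front first and from then on counts as part of the
    -- prefix, so the block keeps its order.
    have h₁ : Red (fun x => (p x ++ (s x).dropLast) ++ (s x).getLast (hne x) :: c x)
        (fun x => (s x).getLast (hne x) :: ((p x ++ (s x).dropLast) ++ c x)) :=
      Red.front (L := L + K) (fun x => by simp [hp x, hs x])
    have h₂ := ih (p := fun x => (s x).getLast (hne x) :: p x) (s := fun x => (s x).dropLast)
      (L := L + 1) (fun x => by simp [hp x]) (fun x => by simp [hs x])
    have h₃ := h₁.trans (by simpa [List.append_assoc] using h₂)
    have e₁ : ∀ x, p x ++ s x ++ c x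
        = (p x ++ (s x).dropLast) ++ (s x).getLast (hne x) :: c x := fun x => by
      conv_lhs => rw [← hsd x]
      simp
    have e₂ : ∀ x, s x ++ p x ++ c x
        = (s x).dropLast ++ (s x).getLast (hne x) :: (p x ++ c x) := fun x => by
      conv_lhs => rw [← hsd x]
      simp
    simp only [e₁, e₂]
    simpa using h₃

/-- Arguments at the end can be ignored. -/
theorem Red.drop {p c : X → List Arg} {L : ℕ} (hp : ∀ x, (p x).length = L) :
    Red (fun x => p x ++ c x) p := fun e =>
  -- S2 and S4 put the constant index in front. S9 then runs it on the first `L` arguments only.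
  ⟨Nat.pair 4 (Nat.pair (Nat.pair 9 L) (Nat.pair 2 e)), fun x v h =>
    Computes.S4 _ _ _ e v (Computes.S2 e _) (by
      rw [← hp x]; exact Computes.S9 e (p x) (c x) v h)⟩

/-- A leading block can be ignored. -/
theorem Red.tail {p c : X → List Arg} {L K : ℕ} (hp : ∀ x, (p x).length = L)
    (hc : ∀ x, (c x).length = K) : Red (fun x => p x ++ c x) c := by
  have h := (Red.block (c := fun _ => []) K hp hc).trans
    ((by simpa using Red.refl _ :
      Red (fun x => c x ++ p x ++ []) (fun x => c x ++ p x)).trans (Red.drop hc))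
  simpa using h

end Red

/-! ## Primitive recursive functions -/

/-- S4 supplies one inner value at a time. A later inner function finds the earlier values in front
of its own arguments, and `Red.block` brings those arguments forward again. -/
theorem exists_index_comp {n : ℕ} (gs : List (List.Vector ℕ n → ℕ))
    (hgs : ∀ g ∈ gs, ∃ e, ∀ (v : List.Vector ℕ n) (c : List Arg),
      Computes e (v.toList.map arg0 ++ c) (g v)) (e : ℕ) :
    ∃ e', ∀ (v : List.Vector ℕ n) (c : List Arg) (y : ℕ),
      Computes e ((gs.map fun g => g v).map arg0 ++ (v.toList.map arg0 ++ c)) y →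
      Computes e' (v.toList.map arg0 ++ c) y := by
  induction gs generalizing e with
  | nil => exact ⟨e, fun v c y h => by simpa using h⟩
  | cons g gs ih =>
    obtain ⟨eg, heg⟩ := hgs g (by simp)
    obtain ⟨eg', heg'⟩ := Red.block (X := List.Vector ℕ n × List Arg) n
      (p := fun x => (gs.map fun g => g x.1).map arg0) (s := fun x => x.1.toList.map arg0)
      (c := fun x => x.2) (L := gs.length) (fun x => by simp) (fun x => by simp) eg
    obtain ⟨e', he'⟩ := ih (fun g hg => hgs g (by simp [hg])) (Nat.pair 4 (Nat.pair e eg'))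
    refine ⟨e', fun v c y h => he' v c y (Computes.S4 _ _ _ (g v) y ?_ (by simpa using h))⟩
    simpa using heg' (v, c) (g v) (by simpa using heg v _)

/-- The clauses of `Nat.Primrec'` correspond to S1-S5, with S6 for the projections. The arbitrary
tail `c` lets the index be used in front of functional arguments. -/
theorem exists_index_primrec' {n : ℕ} {f : List.Vector ℕ n → ℕ} (hf : Nat.Primrec' f) :
    ∃ e, ∀ (v : List.Vector ℕ n) (c : List Arg), Computes e (v.toList.map arg0 ++ c) (f v) := by
  induction hf with
  | zero => exact ⟨_, fun v c => Computes.S2 0 _⟩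
  | succ =>
    refine ⟨Nat.pair 1 0, fun v c => ?_⟩
    obtain ⟨a, w, rfl⟩ := v.exists_eq_cons
    simpa using Computes.S1 a _
  | @get n i =>
    refine ⟨Nat.pair 6 (Nat.pair i (Nat.pair 3 0)), fun v c => ?_⟩
    have hi : (i : ℕ) < v.toList.length := by simp
    have hv : v.toList.map arg0 ++ c =
        (v.toList.take i).map arg0 ++ arg0 (v.get i) :: ((v.toList.drop (i + 1)).map arg0 ++ c) := by
      have : v.toList = v.toList.take i ++ v.get i :: v.toList.drop (i + 1) := by
        conv_lhs => rw [← List.take_append_drop i v.toList]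
        rw [List.drop_eq_getElem_cons hi]
        simp [List.Vector.get_eq_get_toList]
      conv_lhs => rw [this]
      simp
    have := Computes.S6 (Nat.pair 3 0) ((v.toList.take i).map arg0) (arg0 (v.get i))
      ((v.toList.drop (i + 1)).map arg0 ++ c) (v.get i) (Computes.S3 _ _)
    rw [hv]
    simpa [min_eq_left (i.2.le)] using this
  | @comp m n f g hf hg ihf ihg =>
    obtain ⟨ef, hef⟩ := ihf
    obtain ⟨e', he'⟩ := exists_index_comp (List.ofFn g) (by simpa [List.forall_mem_ofFn_iff] using ihg) ef
    refine ⟨e', fun v c => he' v c _ ?_⟩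
    have := hef (List.Vector.ofFn fun i => g i v) (v.toList.map arg0 ++ c)
    simpa [List.map_ofFn, Function.comp_def] using this
  | @prec n f g hf hg ihf ihg =>
    obtain ⟨ef, hef⟩ := ihf
    obtain ⟨eg, heg⟩ := ihg
    refine ⟨Nat.pair 5 (Nat.pair ef eg), fun v c => ?_⟩
    obtain ⟨a, w, rfl⟩ := v.exists_eq_cons
    simp only [List.Vector.toList_cons, List.map_cons, List.cons_append, List.Vector.head_cons,
      List.Vector.tail_cons]
    induction a with
    | zero => exact Computes.S5_zero _ _ _ _ (hef w c)
    | succ a ih => exact Computes.S5_succ _ _ _ _ _ _ ih (by simpa using heg (a ::ᵥ _ ::ᵥ w) c)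

theorem exists_index_primrec {f : ℕ → ℕ} (hf : Nat.Primrec f) :
    ∃ e, ∀ (n : ℕ) (c : List Arg), Computes e (arg0 n :: c) (f n) := by
  obtain ⟨e, he⟩ := exists_index_primrec' (Nat.Primrec'.prim_iff₁.2 (Primrec.nat_iff.2 hf))
  exact ⟨e, fun n c => by simpa using he (n ::ᵥ List.Vector.nil) c⟩

theorem exists_index_pair :
    ∃ e, ∀ (m n : ℕ) (c : List Arg), Computes e (arg0 m :: arg0 n :: c) (Nat.pair m n) := by
  obtain ⟨e, he⟩ := exists_index_primrec' (Nat.Primrec'.prim_iff₂.2 Primrec₂.natPair)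
  exact ⟨e, fun m n c => by simpa using he (m ::ᵥ n ::ᵥ List.Vector.nil) c⟩

theorem Red.skip {X : Type*} {q d b : X → List Arg} {K M L : ℕ} (hq : ∀ x, (q x).length = K)
    (hd : ∀ x, (d x).length = M) (hb : ∀ x, (b x).length = L) :
    Red (fun x => q x ++ (d x ++ b x)) (fun x => q x ++ b x) := by
  have h₁ := Red.block (p := fun x => q x ++ d x) (c := fun _ => []) (L := K + M) L
    (fun x => by simp [hq, hd]) hb
  have h₂ := Red.block (p := b) (s := q) (c := d) K hb hq
  have h₃ := Red.drop (p := fun x => q x ++ b x) (c := d) (L := K + L) (fun x => by simp [hq, hb])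
  simp only [List.append_nil, List.append_assoc] at h₁ h₂ h₃ ⊢
  exact (h₁.trans h₂).trans h₃

/-! ## Uniform computability in the functional arguments -/

open Encodable

/-- The numerical function `F` is computable, uniformly in the functional arguments `b x`. -/
def Cp {X σ τ : Type*} [Primcodable σ] [Primcodable τ] (b : X → List Arg) (F : X → σ → τ) : Prop :=
  ∃ e, ∀ x s, Computes e (arg0 (encode s) :: b x) (encode (F x s))

/-- A family of argument lists of a fixed length. -/
class FixedLength {X : Type*} (b : X → List Arg) : Prop where
  exists_length : ∃ L, ∀ x, (b x).length = L

section Cp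

variable {X σ τ ρ : Type*} [Primcodable σ] [Primcodable τ] [Primcodable ρ] {b : X → List Arg}

theorem Cp.of_eq {F G : X → σ → τ} (hF : Cp b F) (h : ∀ x s, F x s = G x s) : Cp b G := by
  have : F = G := by funext x s; exact h x s
  exact this ▸ hF

theorem Cp.of_primrec {g : σ → τ} (hg : Primrec g) : Cp b (fun _ => g) := by
  -- `Primrec g` speaks of the code of an `Option`, which for `some` is a successor; the predecessor
  -- removes it.
  obtain ⟨e, he⟩ := exists_index_primrec (Nat.Primrec.comp Nat.Primrec.pred hg)
  exact ⟨e, fun x s => by simpa using he (encode s) (b x)⟩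

theorem Cp.id : Cp b (fun _ (s : σ) => s) := Cp.of_primrec Primrec.id

theorem Cp.const (t : τ) : Cp b (fun _ (_ : σ) => t) := Cp.of_primrec (Primrec.const t)

/-- Application of an argument of type 1. -/
theorem Cp.app_type_one {α : X → ℕ → ℕ} (a c : X → List Arg) {K : ℕ}
    (ha : ∀ x, (a x).length = K) (hbα : ∀ x, b x = a x ++ arg1 (α x) :: c x) :
    Cp b (fun x (n : ℕ) => α x n) := by
  obtain ⟨e, he⟩ := Red.front (X := X × ℕ) (p := fun z => arg0 z.2 :: a z.1) (z := fun z => arg1 (α z.1))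
    (c := fun z => c z.1) (L := K + 1) (fun z => by simp [ha]) (Nat.pair 7 0)
  exact ⟨e, fun x n => by simpa [hbα] using he (x, n) _ (Computes.S7 _ _ _)⟩

/-- Application of an argument of type 2. -/
theorem Cp.app_type_two {Y : X → (ℕ → ℕ) → ℕ} (a c : X → List Arg) {K M : ℕ}
    (ha : ∀ x, (a x).length = K) (hc : ∀ x, (c x).length = M)
    (hbY : ∀ x, b x = a x ++ arg2 (Y x) :: c x) {G : X → σ × ℕ → ℕ} (hG : Cp b G) :
    Cp b (fun x s => Y x (fun n => G x (s, n))) := by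
  obtain ⟨eG, hG⟩ := hG
  obtain ⟨ep, hp⟩ := exists_index_pair
  obtain ⟨ep', hp'⟩ := Red.tail (X := X × ℕ × ℕ) (p := fun z => [arg2 (Y z.1)])
    (c := fun z => arg0 z.2.1 :: arg0 z.2.2 :: (a z.1 ++ c z.1)) (L := 1) (K := K + M + 2)
    (fun _ => rfl) (fun z => by simp [ha, hc]) (Nat.pair 6 (Nat.pair 1 ep))
  -- S8 demands the functional first and the bound variable `n` second. Once the pair of `s` and `n`
  -- stands in front, both numbers are discarded and the functional returns to its place behind `a`.
  obtain ⟨eG', hG'⟩ : ∃ e', ∀ (z : X × ℕ × ℕ × ℕ) (v : ℕ),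
      Computes eG (arg0 z.2.1 :: b z.1) v →
      Computes e' (arg0 z.2.1 :: arg2 (Y z.1) :: arg0 z.2.2.1 :: arg0 z.2.2.2 ::
        (a z.1 ++ c z.1)) v := by
    have h₁ := Red.skip (X := X × ℕ × ℕ × ℕ) (q := fun z => [arg0 z.2.1, arg2 (Y z.1)])
      (d := fun z => [arg0 z.2.2.1, arg0 z.2.2.2]) (b := fun z => a z.1 ++ c z.1)
      (K := 2) (M := 2) (fun _ => rfl) (fun _ => rfl)
      (fun z => by rw [List.length_append, ha, hc])
    have h₂ := Red.block (X := X × ℕ × ℕ × ℕ) K (p := fun z => [arg0 z.2.1, arg2 (Y z.1)])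
      (s := fun z => a z.1) (c := fun z => c z.1) (L := 2) (fun _ => rfl) (fun z => ha _)
    have h₃ := Red.front (X := X × ℕ × ℕ × ℕ) (p := fun z => a z.1) (z := fun z => arg0 z.2.1)
      (c := fun z => arg2 (Y z.1) :: c z.1) (fun z => ha _)
    simp only [List.append_assoc, List.cons_append, List.nil_append] at h₁ h₂ h₃
    obtain ⟨e', he'⟩ := (h₁.trans (h₂.trans h₃)) eG
    exact ⟨e', fun z v h => he' z v (by simpa [hbY] using h)⟩
  obtain ⟨e, he⟩ := Red.front (X := X × ℕ) (p := fun z => arg0 z.2 :: a z.1) (z := fun z => arg2 (Y z.1))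
    (c := fun z => c z.1) (L := K + 1) (fun z => by simp [ha])
    (Nat.pair 8 (Nat.pair 0 (Nat.pair 4 (Nat.pair eG' ep'))))
  refine ⟨e, fun x s => ?_⟩
  have key : Computes (Nat.pair 8 (Nat.pair 0 (Nat.pair 4 (Nat.pair eG' ep'))))
      (arg2 (Y x) :: (arg0 (encode s) :: (a x ++ c x))) (Y x fun n => G x (s, n)) := by
    refine Computes.S8 0 _ (Y x) _ (fun n : ℕ => G x (s, n)) fun n : ℕ => ?_
    refine Computes.S4 _ _ _ (Nat.pair (encode s) n) _ (hp' (x, n, encode s) _ ?_)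
      (hG' (x, Nat.pair (encode s) n, n, encode s) _ ?_)
    · exact Computes.S6 ep [arg0 n] (arg0 (encode s)) _ _ (hp _ _ _)
    · simpa using hG x (s, n)
  simpa [hbY] using he (x, encode s) _ key

variable [hb : FixedLength b]

theorem Cp.pair {F : X → σ → τ} {G : X → σ → ρ} (hF : Cp b F) (hG : Cp b G) :
    Cp b (fun x s => (F x s, G x s)) := by
  obtain ⟨L, hL⟩ := hb.exists_length
  obtain ⟨eF, hF⟩ := hF
  obtain ⟨eG, hG⟩ := hG
  obtain ⟨ep, hp⟩ := exists_index_pair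
  obtain ⟨eF', hF'⟩ := Red.tail (X := X × σ × ℕ) (p := fun z => [arg0 z.2.2])
    (c := fun z => arg0 (encode z.2.1) :: b z.1) (L := 1) (K := L + 1) (fun _ => rfl)
    (fun z => by simp [hL]) eF
  refine ⟨Nat.pair 4 (Nat.pair (Nat.pair 4 (Nat.pair ep eF')) eG), fun x s => ?_⟩
  refine Computes.S4 _ _ _ _ _ (hG x s) (Computes.S4 _ _ _ (encode (F x s)) _ ?_ ?_)
  · exact hF' (x, s, encode (G x s)) _ (hF x s)
  · simpa using hp _ _ _

theorem Cp.comp {F : X → τ → ρ} {G : X → σ → τ} (hF : Cp b F) (hG : Cp b G) :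
    Cp b (fun x s => F x (G x s)) := by
  obtain ⟨L, hL⟩ := hb.exists_length
  obtain ⟨eF, hF⟩ := hF
  obtain ⟨eG, hG⟩ := hG
  obtain ⟨eF', hF'⟩ := Red.skip (X := X × ℕ × ℕ) (q := fun z => [arg0 z.2.1])
    (d := fun z => [arg0 z.2.2]) (b := fun z => b z.1) (fun _ => rfl) (fun _ => rfl)
    (fun z => hL z.1) eF
  exact ⟨Nat.pair 4 (Nat.pair eF' eG), fun x s => Computes.S4 _ _ _ _ _ (hG x s)
    (hF' (x, encode (G x s), encode s) _ (hF x (G x s)))⟩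

theorem Cp.comp_primrec {g : τ → ρ} {G : X → σ → τ} (hg : Primrec g) (hG : Cp b G) :
    Cp b (fun x s => g (G x s)) := (Cp.of_primrec hg).comp hG

theorem Cp.comp_primrec₂ {κ : Type*} [Primcodable κ] {g : τ → κ → ρ} {G : X → σ → τ} {H : X → σ → κ}
    (hg : Primrec₂ g) (hG : Cp b G) (hH : Cp b H) :
    Cp b (fun x s => g (G x s) (H x s)) := Cp.comp_primrec hg (hG.pair hH)

theorem Cp.fst {G : X → σ → τ × ρ} (hG : Cp b G) : Cp b (fun x s => (G x s).1) :=
  Cp.comp_primrec Primrec.fst hG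

theorem Cp.snd {G : X → σ → τ × ρ} (hG : Cp b G) : Cp b (fun x s => (G x s).2) :=
  Cp.comp_primrec Primrec.snd hG

/-- Primitive recursion. -/
theorem Cp.prec {F : X → σ → τ} {G : X → σ × ℕ × τ → τ} (hF : Cp b F) (hG : Cp b G) :
    Cp b (fun x (p : σ × ℕ) =>
      (Nat.rec (F x p.1) (fun n ih => G x (p.1, n, ih)) p.2 : τ)) := by
  obtain ⟨L, hL⟩ := hb.exists_length
  obtain ⟨eF, hF⟩ := hF
  obtain ⟨eG, hG⟩ := hG
  obtain ⟨ep, hp⟩ := exists_index_pair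
  obtain ⟨el, hl⟩ := exists_index_primrec Nat.Primrec.left
  obtain ⟨er, hr⟩ := exists_index_primrec Nat.Primrec.right
  -- the step function on the arguments `n, ih, s, b`
  obtain ⟨eG', hG'⟩ := Red.skip (X := X × ℕ × List Arg) (q := fun z => [arg0 z.2.1])
    -- The padding gives length four for every list in the index type; only lists with four entries
    -- are used.
    (d := fun z => z.2.2.take 4 ++ List.replicate (4 - z.2.2.length) (arg0 0))
    (b := fun z => b z.1) (K := 1) (M := 4) (fun _ => rfl)
    (fun z => by simp; omega) (fun z => hL z.1) eG
  let st := Nat.pair 4 (Nat.pair (Nat.pair 4 (Nat.pair eG' (Nat.pair 6 (Nat.pair 3 ep)))) ep)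
  have hst : ∀ x s n (t : τ), Computes st
      (arg0 n :: arg0 (encode t) :: arg0 (encode s) :: b x) (encode (G x (s, n, t))) := by
    intro x s n t
    refine Computes.S4 _ _ _ _ _ (hp _ _ _) (Computes.S4 _ _ _ (encode (s, n, t)) _ ?_ ?_)
    · refine Computes.S6 ep [arg0 (Nat.pair n (encode t)), arg0 n, arg0 (encode t)]
        (arg0 (encode s)) (b x) _ ?_
      simpa using hp _ _ _
    · have := hG' (x, encode (s, n, t), [arg0 (Nat.pair n (encode t)), arg0 n, arg0 (encode t),
        arg0 (encode s)]) (encode (G x (s, n, t))) (by simpa using hG x (s, n, t))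
      simpa using this
  have hrec : ∀ x s n, Computes (Nat.pair 5 (Nat.pair eF st)) (arg0 n :: arg0 (encode s) :: b x)
      (encode (Nat.rec (F x s) (fun n ih => G x (s, n, ih)) n : τ)) := by
    intro x s n
    induction n with
    | zero => exact Computes.S5_zero _ _ _ _ (hF x s)
    | succ n ih => exact Computes.S5_succ _ _ _ _ _ _ ih (hst _ _ _ _)
  obtain ⟨e', he'⟩ := Red.skip (X := X × ℕ × ℕ × ℕ) (q := fun z => [arg0 z.2.1, arg0 z.2.2.1])
    (d := fun z => [arg0 z.2.2.2]) (b := fun z => b z.1) (K := 2) (M := 1) (fun _ => rfl)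
    (fun _ => rfl) (fun z => hL z.1) (Nat.pair 5 (Nat.pair eF st))
  refine ⟨Nat.pair 4 (Nat.pair (Nat.pair 4 (Nat.pair e' (Nat.pair 6 (Nat.pair 1 er)))) el),
    fun x p => ?_⟩
  have h₁ := hl (encode p) (b x)
  have h₂ := hr (encode p) (arg0 (encode p.1) :: b x)
  have h₃ := he' (x, p.2, encode p.1, encode p) _ (hrec x p.1 p.2)
  obtain ⟨s, n⟩ := p
  simp only [Encodable.encode_prod_val, Encodable.encode_nat, Nat.unpair_pair] at h₁ h₂ h₃ ⊢
  exact Computes.S4 _ _ _ _ _ h₁ (Computes.S4 _ _ _ _ _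
    (Computes.S6 er [arg0 (encode s)] (arg0 (Nat.pair (encode s) n)) (b x) _ h₂) h₃)

/-- Unbounded search, by the recursion that S9 provides. -/
theorem Cp.search {T : X → σ × ℕ → ℕ} (hT : Cp b T) (h : ∀ x s, ∃ n, T x (s, n) = 0) :
    Cp b (fun x s => sInf {n | T x (s, n) = 0}) := by
  obtain ⟨L, hL⟩ := hb.exists_length
  obtain ⟨eT, hT⟩ := hT
  obtain ⟨ep, hp⟩ := exists_index_pair
  obtain ⟨eT', hT'⟩ := Red.skip (X := X × ℕ × ℕ × ℕ × ℕ) (q := fun z => [arg0 z.2.1])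
    (d := fun z => [arg0 z.2.2.1, arg0 z.2.2.2.1, arg0 z.2.2.2.2]) (b := fun z => b z.1)
    (K := 1) (M := 3) (fun _ => rfl) (fun _ => rfl) (fun z => hL z.1) eT
  obtain ⟨ep', hp'⟩ := Red.tail (X := X × ℕ × ℕ × ℕ) (p := fun z => [arg0 z.2.1])
    (c := fun z => arg0 z.2.2.1 :: arg0 z.2.2.2 :: b z.1) (L := 1) (K := L + 2)
    (fun _ => rfl) (fun z => by simp [hL]) (Nat.pair 6 (Nat.pair 1 ep))
  have htest : ∀ x s e k, Computes (Nat.pair 4 (Nat.pair eT' ep'))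
      (arg0 e :: arg0 k :: arg0 (encode s) :: b x) (T x (s, k)) := by
    intro x s e k
    refine Computes.S4 _ _ _ (Nat.pair (encode s) k) _
      (hp' (x, e, k, encode s) _ (Computes.S6 ep [arg0 k] (arg0 (encode s)) (b x) _ (hp _ _ _)))
      (hT' (x, Nat.pair (encode s) k, e, k, encode s) _ (by simpa using hT x (s, k)))
  -- the recursive call `{e}(e, k + 1, s)`
  obtain ⟨ec, hc⟩ := Red.skip (X := X × ℕ × ℕ × ℕ × ℕ)
    (q := fun z => [arg0 z.2.1, arg0 z.2.1, arg0 (z.2.2.1 + 1)])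
    (d := fun z => [arg0 z.2.1, arg0 z.2.2.1]) (b := fun z => arg0 z.2.2.2.1 :: b z.1)
    (K := 3) (M := 2) (L := L + 1) (fun _ => rfl) (fun _ => rfl) (fun z => by simp [hL])
    (Nat.pair 9 (3 + L))
  let call := Nat.pair 4 (Nat.pair (Nat.pair 4 (Nat.pair (Nat.pair 4 (Nat.pair ec
    (Nat.pair 3 0))) (Nat.pair 6 (Nat.pair 1 (Nat.pair 3 0))))) (Nat.pair 6 (Nat.pair 1 (Nat.pair 1 0))))
  have hcall : ∀ x (s : σ) e k y, Computes e (arg0 e :: arg0 (k + 1) :: arg0 (encode s) :: b x) y →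
      Computes call (arg0 e :: arg0 k :: arg0 (encode s) :: b x) y := by
    intro x s e k y h
    refine Computes.S4 _ _ _ (k + 1) _
      (Computes.S6 _ [arg0 e] (arg0 k) (arg0 (encode s) :: b x) _ (Computes.S1 _ _)) ?_
    refine Computes.S4 _ _ _ e _
      (Computes.S6 _ [arg0 (k + 1)] (arg0 e) (arg0 k :: arg0 (encode s) :: b x) _
        (Computes.S3 _ _)) ?_
    refine Computes.S4 _ _ _ e _ (Computes.S3 _ _) (hc (x, e, k, encode s, 0) _ ?_)
    have := Computes.S9 e (arg0 e :: arg0 (k + 1) :: arg0 (encode s) :: b x) [] y h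
    simpa [hL, Nat.add_comm, Nat.add_left_comm] using this
  obtain ⟨ec', hc'⟩ := Red.tail (X := X × ℕ × ℕ × ℕ × ℕ × ℕ)
    (p := fun z => [arg0 z.2.1, arg0 z.2.2.1])
    (c := fun z => arg0 z.2.2.2.1 :: arg0 z.2.2.2.2.1 :: arg0 z.2.2.2.2.2 :: b z.1)
    (L := 2) (K := L + 3) (fun _ => rfl) (fun z => by simp [hL]) call
  -- On `e, k, s` this program tests `k` and uses S5 as a case distinction: the base returns `k`,
  -- and the step ignores the previous value and calls `e` on `e, k + 1, s`. Applied to its own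
  -- index it searches upwards from `k`.
  let e₀ := Nat.pair 4 (Nat.pair (Nat.pair 5 (Nat.pair (Nat.pair 6 (Nat.pair 1 (Nat.pair 3 0))) ec'))
    (Nat.pair 4 (Nat.pair eT' ep')))
  have hfound : ∀ x (s : σ) e k, T x (s, k) = 0 →
      Computes e₀ (arg0 e :: arg0 k :: arg0 (encode s) :: b x) k := fun x (s : σ) e k h0 => by
    refine Computes.S4 _ _ _ _ _ (htest x s e k) ?_
    rw [h0]
    exact Computes.S5_zero _ _ _ _
      (Computes.S6 _ [arg0 e] (arg0 k) (arg0 (encode s) :: b x) _ (Computes.S3 _ _))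
  have hnext : ∀ x (s : σ) e k y, T x (s, k) ≠ 0 →
      Computes e (arg0 e :: arg0 (k + 1) :: arg0 (encode s) :: b x) y →
      Computes e₀ (arg0 e :: arg0 k :: arg0 (encode s) :: b x) y := fun x (s : σ) e k y h0 h => by
    refine Computes.S4 _ _ _ _ _ (htest x s e k) ?_
    obtain ⟨t, ht⟩ := Nat.exists_eq_succ_of_ne_zero h0
    rw [ht]
    clear ht
    induction t with
    | zero =>
      exact Computes.S5_succ _ _ _ _ k _ (Computes.S5_zero _ _ _ _
        (Computes.S6 _ [arg0 e] (arg0 k) (arg0 (encode s) :: b x) _ (Computes.S3 _ _)))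
        (hc' (x, 0, k, e, k, encode s) _ (hcall x s e k y h))
    | succ t ih =>
      exact Computes.S5_succ _ _ _ _ y _ ih
        (hc' (x, t + 1, y, e, k, encode s) _ (hcall x s e k y h))
  -- The induction is on the distance `d` from `k` to the least zero, so each run rests on the run
  -- that starts at `k + 1`.
  have hrun : ∀ x s d k, k + d = sInf {n | T x (s, n) = 0} →
      Computes e₀ (arg0 e₀ :: arg0 k :: arg0 (encode s) :: b x) (sInf {n | T x (s, n) = 0}) := by
    intro x s d
    induction d with
    | zero =>
      intro k hk
      rw [add_zero] at hk
      rw [← hk]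
      exact hfound x s e₀ k (hk ▸ Nat.sInf_mem (h x s))
    | succ d ih =>
      intro k hk
      exact hnext x s e₀ k _ (fun h0 => Nat.notMem_of_lt_sInf (s := {n | T x (s, n) = 0}) (by omega) h0)
        (ih (k + 1) (by omega))
  exact ⟨Nat.pair 4 (Nat.pair (Nat.pair 4 (Nat.pair e₀ (Nat.pair 2 e₀))) (Nat.pair 2 0)),
    fun x s => Computes.S4 _ _ _ 0 _ (Computes.S2 0 _)
      (Computes.S4 _ _ _ e₀ _ (Computes.S2 e₀ _) (hrun x s _ 0 (Nat.zero_add _)))⟩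

end Cp
-- Decidable predicates and quantification over numbers by ∃².
open Encodable

/-- The argument families that start with the quantifier `∃²`. -/
class HasE2 {X : Type*} (b : X → List Arg) : Prop extends FixedLength b where
  exists_tail : ∃ c : X → List Arg, ∀ x, b x = arg2 E2 :: c x

section Decidability

variable {X σ τ : Type*} [Primcodable σ] [Primcodable τ] {b : X → List Arg}

/-- The predicate `P` is decidable, uniformly in the functional arguments `b x`. -/
def Dec (b : X → List Arg) (P : X → σ → Prop) : Prop :=
  ∃ F : X → σ → Bool, Cp b F ∧ ∀ x s, F x s = true ↔ P x s

theorem Dec.of_iff {P Q : X → σ → Prop} (hP : Dec b P) (h : ∀ x s, P x s ↔ Q x s) : Dec b Q := by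
  obtain ⟨F, hF, hFP⟩ := hP
  exact ⟨F, hF, fun x s => (hFP x s).trans (h x s)⟩

variable [hb : FixedLength b]

theorem Dec.comp {P : X → τ → Prop} {G : X → σ → τ} (hP : Dec b P) (hG : Cp b G) :
    Dec b (fun x s => P x (G x s)) := by
  obtain ⟨F, hF, hFP⟩ := hP
  exact ⟨_, hF.comp hG, fun x s => hFP x _⟩

theorem Dec.not {P : X → σ → Prop} (hP : Dec b P) : Dec b (fun x s => ¬ P x s) := by
  obtain ⟨F, hF, hFP⟩ := hP
  exact ⟨_, Cp.comp_primrec Primrec.not hF, fun x s => by simp [← hFP]⟩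

theorem Dec.and {P Q : X → σ → Prop} (hP : Dec b P) (hQ : Dec b Q) :
    Dec b (fun x s => P x s ∧ Q x s) := by
  obtain ⟨F, hF, hFP⟩ := hP
  obtain ⟨G, hG, hGP⟩ := hQ
  exact ⟨_, Cp.comp_primrec₂ Primrec.and hF hG, fun x s => by simp [← hFP, ← hGP]⟩

theorem Dec.or {P Q : X → σ → Prop} (hP : Dec b P) (hQ : Dec b Q) :
    Dec b (fun x s => P x s ∨ Q x s) :=
  (hP.not.and hQ.not).not.of_iff fun x s => by tauto

theorem Dec.imp {P Q : X → σ → Prop} (hP : Dec b P) (hQ : Dec b Q) :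
    Dec b (fun x s => P x s → Q x s) :=
  (hP.not.or hQ).of_iff fun x s => by tauto

theorem Cp.nat_lt {F G : X → σ → ℕ} (hF : Cp b F) (hG : Cp b G) :
    Dec b (fun x s => F x s < G x s) := by
  obtain ⟨_, h⟩ := (Primrec.nat_lt : PrimrecRel ((· < ·) : ℕ → ℕ → Prop))
  exact ⟨_, Cp.comp_primrec h (hF.pair hG), fun x s => by simp⟩

theorem Dec.ite {P : X → σ → Prop} {F G : X → σ → τ} [∀ x s, Decidable (P x s)] (hP : Dec b P)
    (hF : Cp b F) (hG : Cp b G) : Cp b (fun x s => if P x s then F x s else G x s) := by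
  obtain ⟨C, hC, hCP⟩ := hP
  refine (Cp.comp_primrec (Primrec.cond Primrec.fst (Primrec.fst.comp Primrec.snd)
    (Primrec.snd.comp Primrec.snd)) (hC.pair (hF.pair hG))).of_eq fun x s => ?_
  by_cases h : P x s
  · simp [h, (hCP x s).2 h]
  · simp [h, Bool.eq_false_iff.2 (fun h' => h ((hCP x s).1 h'))]

end Decidability

section Quantifiers

variable {X σ τ : Type*} [Primcodable σ] [Primcodable τ] {b : X → List Arg} [hE : HasE2 b]

/-- The only place where ∃² is applied. -/
theorem Dec.ex {P : X → σ → ℕ → Prop} (hP : Dec b (fun x (p : σ × ℕ) => P x p.1 p.2)) :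
    Dec b (fun x s => ∃ n, P x s n) := by
  obtain ⟨F, hF, hFP⟩ := hP
  obtain ⟨L, hL⟩ := hE.exists_length
  obtain ⟨c, hc⟩ := hE.exists_tail
  have h₁ : Cp b (fun x (p : σ × ℕ) => if F x p then 0 else 1) :=
    Dec.ite ⟨F, hF, fun _ _ => Iff.rfl⟩ (Cp.const 0) (Cp.const 1)
  have h₂ := Cp.app_type_two (Y := fun _ => E2) (fun _ => []) c (K := 0) (M := L - 1) (fun _ => rfl)
    (fun x => by have := hL x; rw [hc] at this; simp at this; omega) (fun x => by simp [hc]) h₁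
  refine (Cp.nat_lt h₂ (Cp.const 1)).of_iff fun x s => ?_
  simp only [E2]
  rw [← exists_congr fun n => hFP x (s, n)]
  by_cases h : ∃ n, F x (s, n) = true <;> simp [h]

theorem Dec.all {P : X → σ → ℕ → Prop} (hP : Dec b (fun x (p : σ × ℕ) => P x p.1 p.2)) :
    Dec b (fun x s => ∀ n, P x s n) :=
  (Dec.ex (P := fun x s n => ¬ P x s n) hP.not).not.of_iff fun x s => by simp

theorem Dec.sInf {P : X → σ → ℕ → Prop} (hP : Dec b (fun x (p : σ × ℕ) => P x p.1 p.2)) :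
    Cp b (fun x s => sInf {n | P x s n}) := by
  classical
  -- The search must terminate for all arguments. Without a witness the modified condition holds
  -- everywhere, and the search returns 0, which is also the infimum of the empty set in `ℕ`.
  have h₁ : Dec b (fun x (p : σ × ℕ) => P x p.1 p.2 ∨ ¬ ∃ n, P x p.1 n) :=
    hP.or ((Dec.ex hP).not.comp (Cp.of_primrec Primrec.fst))
  have h₂ : Cp b (fun x (p : σ × ℕ) => if P x p.1 p.2 ∨ ¬ ∃ n, P x p.1 n then 0 else 1) :=
    Dec.ite h₁ (Cp.const 0) (Cp.const 1)
  refine (Cp.search h₂ fun x s => ?_).of_eq fun x s => ?_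
  · by_cases h : ∃ n, P x s n
    · obtain ⟨n, hn⟩ := h
      exact ⟨n, by simp [hn]⟩
    · exact ⟨0, by simp [h]⟩
  · by_cases h : ∃ n, P x s n
    · simp [h]
    · have h' : {n | P x s n} = ∅ := by
        ext n
        simpa using fun hn => h ⟨n, hn⟩
      simp [h, h']

end Quantifiers

/-! ## Codes of rational numbers -/

theorem ratOf_pair (i j k : ℕ) :
    (ratOf (Nat.pair i (Nat.pair j k)) : ℝ) = ((i : ℝ) - j) / (k + 1) := by
  simp [ratOf]

theorem exists_code (n : ℕ) : ∃ i j k, n = Nat.pair i (Nat.pair j k) :=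
  ⟨n.unpair.1, n.unpair.2.unpair.1, n.unpair.2.unpair.2, by simp⟩

theorem exists_ratOf_eq (q : ℚ) : ∃ n, ratOf n = q := by
  -- The positive and negative parts of the numerator; `ratOf` adds one to the last component.
  refine ⟨Nat.pair q.num.toNat (Nat.pair (-q.num).toNat (q.den - 1)), ?_⟩
  have h := q.den_pos
  have h₂ : ((q.num.toNat : ℕ) : ℚ) - ((-q.num).toNat : ℕ) = q.num := by
    have : ((q.num.toNat : ℕ) : ℤ) - ((-q.num).toNat : ℕ) = q.num := by omega
    exact_mod_cast this
  have h₃ : ((q.den - 1 : ℕ) : ℚ) + 1 = q.den := by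
    have : (q.den - 1 : ℕ) + 1 = q.den := by omega
    exact_mod_cast this
  simp only [ratOf, Nat.unpair_pair, h₂, h₃]
  exact q.num_div_den

theorem exists_ratOf_btwn {a c : ℝ} (h : a < c) : ∃ n, a < ratOf n ∧ (ratOf n : ℝ) < c := by
  obtain ⟨q, h₁, h₂⟩ := exists_rat_btwn h
  obtain ⟨n, rfl⟩ := exists_ratOf_eq q
  exact ⟨n, h₁, h₂⟩

/-- A code of the sum of two coded rationals. -/
def addCode (a c : ℕ) : ℕ :=
  Nat.pair (a.unpair.1 * (c.unpair.2.unpair.2 + 1) + c.unpair.1 * (a.unpair.2.unpair.2 + 1))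
    (Nat.pair (a.unpair.2.unpair.1 * (c.unpair.2.unpair.2 + 1) +
        c.unpair.2.unpair.1 * (a.unpair.2.unpair.2 + 1))
      -- This is (k + 1)(k' + 1) - 1, as denominators are stored diminished by one.
      (a.unpair.2.unpair.2 * c.unpair.2.unpair.2 + a.unpair.2.unpair.2 + c.unpair.2.unpair.2))

theorem ratOf_addCode (a c : ℕ) : (ratOf (addCode a c) : ℝ) = ratOf a + ratOf c := by
  obtain ⟨i, j, k, rfl⟩ := exists_code a
  obtain ⟨i', j', k', rfl⟩ := exists_code c
  simp only [addCode, Nat.unpair_pair, ratOf_pair]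
  push_cast
  have h₁ : (k : ℝ) + 1 ≠ 0 := by positivity
  have h₂ : (k' : ℝ) + 1 ≠ 0 := by positivity
  have h₃ : (k : ℝ) * k' + k + k' + 1 ≠ 0 := by positivity
  field_simp
  ring

/-- A code of the negative of a coded rational. -/
def negCode (a : ℕ) : ℕ := Nat.pair a.unpair.2.unpair.1 (Nat.pair a.unpair.1 a.unpair.2.unpair.2)

theorem ratOf_negCode (a : ℕ) : (ratOf (negCode a) : ℝ) = -ratOf a := by
  obtain ⟨i, j, k, rfl⟩ := exists_code a
  simp only [negCode, Nat.unpair_pair, ratOf_pair]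
  ring

/-- A code of `i / 2 ^ N`. -/
def dyadicCode (i N : ℕ) : ℕ := Nat.pair i (Nat.pair 0 (2 ^ N - 1))

theorem ratOf_dyadicCode (i N : ℕ) : (ratOf (dyadicCode i N) : ℝ) = i / 2 ^ N := by
  have : ((2 ^ N - 1 : ℕ) : ℝ) + 1 = 2 ^ N := by
    have : (2 ^ N - 1 : ℕ) + 1 = 2 ^ N := Nat.sub_add_cancel Nat.one_le_two_pow
    exact_mod_cast this
  rw [dyadicCode, ratOf_pair, this]
  simp

theorem ratOf_lt_iff (a c : ℕ) : (ratOf a : ℝ) < ratOf c ↔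
    a.unpair.1 * (c.unpair.2.unpair.2 + 1) + c.unpair.2.unpair.1 * (a.unpair.2.unpair.2 + 1) <
      c.unpair.1 * (a.unpair.2.unpair.2 + 1) + a.unpair.2.unpair.1 * (c.unpair.2.unpair.2 + 1) := by
  obtain ⟨i, j, k, rfl⟩ := exists_code a
  obtain ⟨i', j', k', rfl⟩ := exists_code c
  simp only [Nat.unpair_pair, ratOf_pair]
  have h₁ : (0 : ℝ) < k + 1 := by positivity
  have h₂ : (0 : ℝ) < k' + 1 := by positivity
  rw [div_lt_div_iff₀ h₁ h₂, ← @Nat.cast_lt ℝ]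
  push_cast
  constructor <;> intro h <;> linarith

section RationalCodes

variable {X σ : Type*} [Primcodable σ] {b : X → List Arg} [FixedLength b]

theorem Cp.num {F : X → σ → ℕ} (hF : Cp b F) : Cp b (fun x s => (F x s).unpair.1) :=
  (Cp.comp_primrec Primrec.unpair hF).fst

theorem Cp.unpair_snd {F : X → σ → ℕ} (hF : Cp b F) : Cp b (fun x s => (F x s).unpair.2) :=
  (Cp.comp_primrec Primrec.unpair hF).snd

theorem Cp.add {F G : X → σ → ℕ} (hF : Cp b F) (hG : Cp b G) : Cp b (fun x s => F x s + G x s) :=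
  Cp.comp_primrec₂ Primrec.nat_add hF hG

theorem Cp.mul {F G : X → σ → ℕ} (hF : Cp b F) (hG : Cp b G) : Cp b (fun x s => F x s * G x s) :=
  Cp.comp_primrec₂ Primrec.nat_mul hF hG

theorem Cp.nat_pair {F G : X → σ → ℕ} (hF : Cp b F) (hG : Cp b G) :
    Cp b (fun x s => Nat.pair (F x s) (G x s)) :=
  Cp.comp_primrec₂ Primrec₂.natPair hF hG

theorem primrec_two_pow : Primrec (fun n : ℕ => 2 ^ n) :=
  (Primrec.nat_rec₁ 1 (f := fun _ m => m * 2)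
    (Primrec.nat_mul.comp Primrec.snd (Primrec.const 2)).to₂).of_eq fun n => by
    induction n with
    | zero => rfl
    | succ n ih => rw [pow_succ, ← ih]

theorem Cp.two_pow {F : X → σ → ℕ} (hF : Cp b F) : Cp b (fun x s => 2 ^ F x s) :=
  Cp.comp_primrec primrec_two_pow hF

theorem Cp.addCode {F G : X → σ → ℕ} (hF : Cp b F) (hG : Cp b G) :
    Cp b (fun x s => addCode (F x s) (G x s)) := by
  have f₁ := hF.num
  have f₂ := hF.unpair_snd.num
  have f₃ := hF.unpair_snd.unpair_snd
  have g₁ := hG.num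
  have g₂ := hG.unpair_snd.num
  have g₃ := hG.unpair_snd.unpair_snd
  exact ((f₁.mul (g₃.add (Cp.const 1))).add (g₁.mul (f₃.add (Cp.const 1)))).nat_pair
    (((f₂.mul (g₃.add (Cp.const 1))).add (g₂.mul (f₃.add (Cp.const 1)))).nat_pair
      (((f₃.mul g₃).add f₃).add g₃))

theorem Cp.negCode {F : X → σ → ℕ} (hF : Cp b F) : Cp b (fun x s => negCode (F x s)) :=
  hF.unpair_snd.num.nat_pair (hF.num.nat_pair hF.unpair_snd.unpair_snd)

theorem Cp.dyadicCode {F G : X → σ → ℕ} (hF : Cp b F) (hG : Cp b G) :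
    Cp b (fun x s => dyadicCode (F x s) (G x s)) :=
  hF.nat_pair ((Cp.const 0).nat_pair (Cp.comp_primrec Primrec.pred hG.two_pow))

theorem Cp.ratOf_lt {F G : X → σ → ℕ} (hF : Cp b F) (hG : Cp b G) :
    Dec b (fun x s => (ratOf (F x s) : ℝ) < ratOf (G x s)) := by
  have f₁ := hF.num
  have f₂ := hF.unpair_snd.num
  have f₃ := hF.unpair_snd.unpair_snd
  have g₁ := hG.num
  have g₂ := hG.unpair_snd.num
  have g₃ := hG.unpair_snd.unpair_snd
  exact (Cp.nat_lt ((f₁.mul (g₃.add (Cp.const 1))).add (g₂.mul (f₃.add (Cp.const 1))))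
    ((g₁.mul (f₃.add (Cp.const 1))).add (f₂.mul (g₃.add (Cp.const 1))))).of_iff
    fun x s => (ratOf_lt_iff _ _).symm

end RationalCodes

/-! ## Real numbers computable in `∃²` -/

/-- The real-valued function `R` has a decidable left cut, uniformly in the functional arguments
`b x`. -/
def CR {X σ : Type*} [Primcodable σ] (b : X → List Arg) (R : X → σ → ℝ) : Prop :=
  Dec b (fun x (p : σ × ℕ) => (ratOf p.2 : ℝ) < R x p.1)

section CR

variable {X σ τ : Type*} [Primcodable σ] [Primcodable τ] {b : X → List Arg}

theorem CR.of_eq {R S : X → σ → ℝ} (hR : CR b R) (h : ∀ x s, R x s = S x s) : CR b S := by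
  have : R = S := by funext x s; exact h x s
  exact this ▸ hR

variable [hE : HasE2 b]

theorem CR.comp {R : X → τ → ℝ} {G : X → σ → τ} (hR : CR b R) (hG : Cp b G) :
    CR b (fun x s => R x (G x s)) :=
  Dec.comp (P := fun x (p : τ × ℕ) => (ratOf p.2 : ℝ) < R x p.1)
    (G := fun x (p : σ × ℕ) => (G x p.1, p.2)) hR ((hG.comp Cp.id.fst).pair Cp.id.snd)

theorem CR.cut {R : X → σ → ℝ} {c : X → σ → ℕ} (hR : CR b R) (hc : Cp b c) :
    Dec b (fun x s => (ratOf (c x s) : ℝ) < R x s) :=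
  Dec.comp (P := fun x (p : σ × ℕ) => (ratOf p.2 : ℝ) < R x p.1)
    (G := fun x s => (s, c x s)) hR (Cp.id.pair hc)

theorem CR.of_code {c : X → σ → ℕ} (hc : Cp b c) : CR b (fun x s => (ratOf (c x s) : ℝ)) :=
  Cp.ratOf_lt Cp.id.snd (hc.comp Cp.id.fst)

theorem CR.dyadic {i N : X → σ → ℕ} (hi : Cp b i) (hN : Cp b N) :
    CR b (fun x s => (i x s : ℝ) / 2 ^ N x s) :=
  (CR.of_code (hi.dyadicCode hN)).of_eq fun _ _ => ratOf_dyadicCode _ _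

theorem CR.nat {i : X → σ → ℕ} (hi : Cp b i) : CR b (fun x s => (i x s : ℝ)) :=
  (CR.dyadic hi (Cp.const 0)).of_eq fun x s => by simp

theorem CR.half_pow {N : X → σ → ℕ} (hN : Cp b N) : CR b (fun x s => (1 / 2 : ℝ) ^ N x s) :=
  (CR.dyadic (Cp.const 1) hN).of_eq fun x s => by simp

theorem CR.lt {R S : X → σ → ℝ} (hR : CR b R) (hS : CR b S) : Dec b (fun x s => R x s < S x s) := by
  have h : Dec b (fun x s => ∃ n, ¬ (ratOf n : ℝ) < R x s ∧ (ratOf n : ℝ) < S x s) :=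
    Dec.ex ((Dec.not hR).and hS)
  refine h.of_iff fun x s => ⟨fun ⟨n, h₁, h₂⟩ => (not_lt.1 h₁).trans_lt h₂, fun h => ?_⟩
  obtain ⟨n, h₁, h₂⟩ := exists_ratOf_btwn h
  exact ⟨n, not_lt.2 h₁.le, h₂⟩

theorem CR.le {R S : X → σ → ℝ} (hR : CR b R) (hS : CR b S) : Dec b (fun x s => R x s ≤ S x s) :=
  (hS.lt hR).not.of_iff fun _ _ => not_lt

theorem CR.neg {R : X → σ → ℝ} (hR : CR b R) : CR b (fun x s => -R x s) := by
  have h : Dec b (fun x (p : σ × ℕ) => R x p.1 < ratOf (negCode p.2)) :=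
    (hR.comp Cp.id.fst).lt (CR.of_code Cp.id.snd.negCode)
  exact h.of_iff fun x p => by rw [ratOf_negCode, lt_neg]

theorem CR.add {R S : X → σ → ℝ} (hR : CR b R) (hS : CR b S) : CR b (fun x s => R x s + S x s) := by
  have h : Dec b (fun x (p : σ × ℕ) => ∃ n, (ratOf n : ℝ) < R x p.1 ∧
      (ratOf (addCode p.2 (negCode n)) : ℝ) < S x p.1) :=
    Dec.ex (P := fun x (p : σ × ℕ) n => (ratOf n : ℝ) < R x p.1 ∧
      (ratOf (addCode p.2 (negCode n)) : ℝ) < S x p.1)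
      (((hR.comp Cp.id.fst.fst).cut Cp.id.snd).and
      ((hS.comp Cp.id.fst.fst).cut (Cp.id.fst.snd.addCode Cp.id.snd.negCode)))
  refine h.of_iff fun x p => ?_
  simp only [ratOf_addCode, ratOf_negCode]
  constructor
  · rintro ⟨n, h₁, h₂⟩
    linarith
  · intro h
    obtain ⟨n, h₁, h₂⟩ := exists_ratOf_btwn (show (ratOf p.2 : ℝ) - S x p.1 < R x p.1 by linarith)
    exact ⟨n, h₂, by linarith⟩

theorem CR.sub {R S : X → σ → ℝ} (hR : CR b R) (hS : CR b S) : CR b (fun x s => R x s - S x s) :=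
  (hR.add hS.neg).of_eq fun _ _ => (sub_eq_add_neg _ _).symm

theorem CR.max {R S : X → σ → ℝ} (hR : CR b R) (hS : CR b S) :
    CR b (fun x s => max (R x s) (S x s)) :=
  (Dec.or hR hS).of_iff fun _ _ => lt_max_iff.symm

theorem CR.min {R S : X → σ → ℝ} (hR : CR b R) (hS : CR b S) :
    CR b (fun x s => min (R x s) (S x s)) :=
  (Dec.and hR hS).of_iff fun _ _ => lt_min_iff.symm

theorem CR.abs {R : X → σ → ℝ} (hR : CR b R) : CR b (fun x s => |R x s|) := hR.max hR.neg

theorem CR.iSup {R : X → σ → ℕ → ℝ} (hR : CR b (fun x (p : σ × ℕ) => R x p.1 p.2))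
    (hbd : ∀ x s, BddAbove (range (R x s))) : CR b (fun x s => ⨆ n, R x s n) := by
  have h : Dec b (fun x (p : σ × ℕ) => ∃ n, (ratOf p.2 : ℝ) < R x p.1 n) :=
    Dec.ex (CR.cut (hR.comp (Cp.id.fst.fst.pair Cp.id.snd)) Cp.id.fst.snd)
  exact h.of_iff fun x p => (lt_ciSup_iff (hbd x p.1)).symm

/-- From a decidable left cut one can compute a code of the real number. -/
theorem CR.exists_name {R : X → σ → ℝ} (hR : CR b R) : ∃ β : X → σ → ℕ → ℕ,
    (∀ x s, RealName (β x s) (R x s)) ∧ Cp b (fun x (p : σ × ℕ) => β x p.1 p.2) := by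
  refine ⟨fun x s n => sInf {k | |(ratOf k : ℝ) - R x s| ≤ (1 / 2 : ℝ) ^ n}, fun x s n => ?_, ?_⟩
  · refine Nat.sInf_mem (s := {k | |(ratOf k : ℝ) - R x s| ≤ (1 / 2 : ℝ) ^ n}) ?_
    have hp : (0 : ℝ) < (1 / 2) ^ n := by positivity
    obtain ⟨k, h₁, h₂⟩ := exists_ratOf_btwn (lt_add_of_pos_right (R x s) hp)
    refine ⟨k, ?_⟩
    rw [mem_ofPred_eq, abs_le]
    constructor <;> linarith
  · exact Dec.sInf (P := fun x (p : σ × ℕ) k => |(ratOf k : ℝ) - R x p.1| ≤ (1 / 2 : ℝ) ^ p.2)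
      (((CR.of_code Cp.id.snd).sub (hR.comp Cp.id.fst.fst)).abs.le (CR.half_pow Cp.id.fst.snd))

/-- From a code of a real number one can decide the left cut. -/
theorem CR.of_name {R : X → σ → ℝ} {β : X → σ → ℕ → ℕ} (hβ : ∀ x s, RealName (β x s) (R x s))
    (hc : Cp b (fun x (p : σ × ℕ) => β x p.1 p.2)) : CR b R := by
  have h : Dec b (fun x (p : σ × ℕ) => ∃ n, (ratOf p.2 : ℝ) < ratOf (β x p.1 n) - (1 / 2 : ℝ) ^ n) :=
    Dec.ex ((CR.of_code Cp.id.fst.snd).lt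
      ((CR.of_code (hc.comp (Cp.id.fst.fst.pair Cp.id.snd))).sub (CR.half_pow Cp.id.snd)))
  refine h.of_iff fun x p => ⟨fun ⟨n, hn⟩ => ?_, fun hlt => ?_⟩
  · have := (abs_le.1 (hβ x p.1 n)).2
    linarith
  · obtain ⟨n, hn⟩ := exists_pow_lt_of_lt_one (half_pos (sub_pos.2 hlt))
      (by norm_num : (1 / 2 : ℝ) < 1)
    have := (abs_le.1 (hβ x p.1 n)).1
    exact ⟨n, by linarith⟩

/-- The floor is the least `t` with 2^m R < t + 1. Comparison with a successor stays correct for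
negative `R`, where the floor is 0. -/
theorem CR.nat_floor {R : X → σ → ℝ} {m : X → σ → ℕ} (hR : CR b R) (hm : Cp b m) :
    Cp b (fun x s => ⌊2 ^ m x s * R x s⌋₊) := by
  have h := Dec.sInf (P := fun x s t => R x s < ((t + 1 : ℕ) : ℝ) / 2 ^ m x s)
    ((hR.comp Cp.id.fst).lt (CR.dyadic (Cp.id.snd.add (Cp.const 1)) (hm.comp Cp.id.fst)))
  refine h.of_eq fun x s => ?_
  have hp : (0 : ℝ) < 2 ^ m x s := by positivity
  have hset : {t : ℕ | R x s < ((t + 1 : ℕ) : ℝ) / 2 ^ m x s} = Ici ⌊2 ^ m x s * R x s⌋₊ := by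
    ext t
    rw [mem_ofPred_eq, mem_Ici, lt_div_iff₀ hp, mul_comm, ← Nat.floor_lt' (Nat.succ_ne_zero t),
      Nat.lt_succ_iff]
  rw [hset]
  exact csInf_Ici

theorem Cp.sum {F : X → σ → ℕ → ℕ} {K : X → σ → ℕ}
    (hF : Cp b (fun x (p : σ × ℕ) => F x p.1 p.2)) (hK : Cp b K) :
    Cp b (fun x s => ∑ i ∈ Finset.range (K x s), F x s i) := by
  have h := Cp.prec (b := b) (F := fun _ (_ : σ) => 0)
    (G := fun x (q : σ × ℕ × ℕ) => q.2.2 + F x q.1 q.2.1) (Cp.const 0)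
    (Cp.id.snd.snd.add (hF.comp (Cp.id.fst.pair Cp.id.snd.fst)))
  refine (h.comp (Cp.id.pair hK)).of_eq fun x s => ?_
  induction K x s with
  | zero => rfl
  | succ n ih => rw [Finset.sum_range_succ, ← ih]

/-- Primitive recursion yields numbers, not reals, so a sum with a variable number of terms is
formed from terms rounded down to multiples of 2^(-m). The total error is at most K / 2^m, and the
supremum over `m` removes it. -/
theorem sum_eq_iSup_floor {K : ℕ} {r : ℕ → ℝ} (hr : ∀ i, 0 ≤ r i) :
    BddAbove (range fun m : ℕ => ((∑ i ∈ Finset.range K, ⌊2 ^ m * r i⌋₊ : ℕ) : ℝ) / 2 ^ m) ∧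
    ⨆ m : ℕ, ((∑ i ∈ Finset.range K, ⌊2 ^ m * r i⌋₊ : ℕ) : ℝ) / 2 ^ m =
      ∑ i ∈ Finset.range K, r i := by
  have hle : ∀ m : ℕ, ((∑ i ∈ Finset.range K, ⌊2 ^ m * r i⌋₊ : ℕ) : ℝ) / 2 ^ m ≤
      ∑ i ∈ Finset.range K, r i := fun m => by
    have hp : (0 : ℝ) < 2 ^ m := by positivity
    rw [div_le_iff₀ hp, Nat.cast_sum, Finset.sum_mul]
    refine Finset.sum_le_sum fun i _ => ?_
    rw [mul_comm (r i)]
    exact Nat.floor_le (mul_nonneg hp.le (hr i))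
  refine ⟨⟨_, forall_mem_range.2 hle⟩, ciSup_eq_of_forall_le_of_forall_lt_exists_gt hle ?_⟩
  intro w hw
  have hK : (0 : ℝ) < K + 1 := by positivity
  obtain ⟨m, hm⟩ := exists_pow_lt_of_lt_one (div_pos (sub_pos.2 hw) hK)
    (by norm_num : (1 / 2 : ℝ) < 1)
  refine ⟨m, ?_⟩
  have hp : (0 : ℝ) < 2 ^ m := by positivity
  have h₁ : (∑ i ∈ Finset.range K, r i) * 2 ^ m - K ≤
      ((∑ i ∈ Finset.range K, ⌊2 ^ m * r i⌋₊ : ℕ) : ℝ) := by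
    have : ∑ i ∈ Finset.range K, (r i * 2 ^ m - 1) ≤ ∑ i ∈ Finset.range K, (⌊2 ^ m * r i⌋₊ : ℝ) :=
      Finset.sum_le_sum fun i _ => by
        have := Nat.lt_floor_add_one (2 ^ m * r i)
        linarith
    rw [Finset.sum_sub_distrib, ← Finset.sum_mul] at this
    simpa using this
  rw [lt_div_iff₀ hp]
  rw [one_div, inv_pow, lt_div_iff₀ hK, inv_mul_lt_iff₀ hp] at hm
  nlinarith

/-- Finite sums of nonnegative reals. -/
theorem CR.sum {R : X → σ → ℕ → ℝ} {K : X → σ → ℕ}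
    (hR : CR b (fun x (p : σ × ℕ) => R x p.1 p.2)) (hK : Cp b K) (h0 : ∀ x s i, 0 ≤ R x s i) :
    CR b (fun x s => ∑ i ∈ Finset.range (K x s), R x s i) := by
  have h₁ : Cp b (fun x (p : σ × ℕ) => ∑ i ∈ Finset.range (K x p.1), ⌊2 ^ p.2 * R x p.1 i⌋₊) :=
    Cp.sum (F := fun x (p : σ × ℕ) i => ⌊2 ^ p.2 * R x p.1 i⌋₊)
      ((hR.comp (Cp.id.fst.fst.pair Cp.id.snd)).nat_floor Cp.id.fst.snd) (hK.comp Cp.id.fst)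
  refine (CR.iSup (R := fun x s m =>
    ((∑ i ∈ Finset.range (K x s), ⌊2 ^ m * R x s i⌋₊ : ℕ) : ℝ) / 2 ^ m)
    (CR.dyadic h₁ Cp.id.snd) fun x s => (sum_eq_iSup_floor (h0 x s)).1).of_eq
    fun x s => (sum_eq_iSup_floor (h0 x s)).2

end CR

/-! ## Functions of bounded variation as computational data -/

/-- A function in `IntermediateBV` and `m` real numbers, together with codes of them. -/
structure Datum (m : ℕ) where
  f : ℝ → ℝ
  Y : (ℕ → ℕ) → ℕ
  x : Fin m → ℝ
  α : Fin m → ℕ → ℕ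
  mem : f ∈ IntermediateBV
  funName : FunName Y f
  realName : ∀ i, RealName (α i) (x i)

/-- The functional arguments of a computation on a datum. -/
noncomputable def Datum.args {m : ℕ} (d : Datum m) : List Arg :=
  arg2 E2 :: arg2 d.Y :: List.ofFn (fun i => arg1 (d.α i))

instance (m : ℕ) : HasE2 (Datum.args : Datum m → List Arg) where
  exists_length := ⟨m + 2, fun d => by simp [Datum.args]⟩
  exists_tail := ⟨_, fun _ => rfl⟩

section Datum

variable {m : ℕ} {σ : Type*} [Primcodable σ]

theorem Datum.cr_param (i : Fin m) :
    CR Datum.args (fun (d : Datum m) (_ : σ) => d.x i) := by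
  have h : Cp Datum.args (fun (d : Datum m) (n : ℕ) => d.α i n) := by
    refine Cp.app_type_one
      (fun d => arg2 E2 :: arg2 d.Y :: (List.ofFn (fun j => arg1 (d.α j))).take i)
      (fun d => (List.ofFn (fun j => arg1 (d.α j))).drop (i + 1)) (K := i + 2)
      (fun d => by simp [i.2.le]) (fun d => ?_)
    have hi : (i : ℕ) < (List.ofFn (fun j => arg1 (d.α j))).length := by simp
    have := List.drop_eq_getElem_cons hi
    simp only [List.getElem_ofFn, Fin.eta] at this
    simp only [Datum.args, List.cons_append]
    rw [← this, List.take_append_drop]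
  exact CR.of_name (β := fun d _ => d.α i) (fun d _ => d.realName i) (h.comp Cp.id.snd)

/-- The value of the function at a computable point of the unit interval. -/
theorem Datum.cr_apply {U : Datum m → σ → ℝ} (hU : CR Datum.args U)
    (h01 : ∀ d s, U d s ∈ Icc (0 : ℝ) 1) : CR Datum.args (fun d s => d.f (U d s)) := by
  obtain ⟨β, hβ, hc⟩ := hU.exists_name
  refine CR.of_name (β := fun d s n => d.Y (prepend n (β d s)))
    (fun d s => d.funName _ (h01 d s) _ (hβ d s)) ?_
  have h : Cp Datum.args (fun (d : Datum m) (q : (σ × ℕ) × ℕ) => prepend q.1.2 (β d q.1.1) q.2) := by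
    have h₁ : Cp Datum.args (fun (d : Datum m) (q : (σ × ℕ) × ℕ) =>
        if q.2 < 1 then q.1.2 else β d q.1.1 (q.2 - 1)) :=
      Dec.ite (Cp.nat_lt Cp.id.snd (Cp.const 1)) Cp.id.fst.snd
        (hc.comp (Cp.id.fst.fst.pair (Cp.comp_primrec Primrec.pred Cp.id.snd)))
    refine h₁.of_eq fun d q => ?_
    obtain ⟨⟨s, n⟩, k⟩ := q
    cases k <;> simp [prepend]
  exact Cp.app_type_two (Y := fun d : Datum m => d.Y) (fun _ => [arg2 E2])
    (fun d => List.ofFn fun i => arg1 (d.α i)) (K := 1) (M := m) (fun _ => rfl)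
    (fun d => by simp) (fun d => rfl) h

theorem realComputableInE2_of_cr {C : Set (ℝ → ℝ)} (hC : C ⊆ IntermediateBV)
    {Φ : (ℝ → ℝ) → (Fin m → ℝ) → ℝ}
    (h : CR Datum.args (fun (d : Datum m) (_ : Unit) => Φ d.f d.x)) :
    RealComputableInE2 C m Φ := by
  obtain ⟨β, hβ, hc⟩ := h.exists_name
  obtain ⟨e, he⟩ := hc.comp (G := fun _ n => ((), n)) ((Cp.const ()).pair Cp.id)
  obtain ⟨e', he'⟩ := Red.front (X := Datum m × ℕ) (p := fun z => z.1.args) (z := fun z => arg0 z.2)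
    (c := fun _ => []) (L := m + 2) (fun z => by simp [Datum.args]) e
  refine ⟨e', fun f hf Y hY x α hα => ?_⟩
  let d : Datum m := ⟨f, Y, x, α, hC hf, hY, hα⟩
  refine ⟨β d (), hβ d (), fun n => ?_⟩
  simpa [Datum.args, d] using he' (d, n) _ (by simpa using he d n)

theorem modulusComputableInE2_of_cp {C : Set (ℝ → ℝ)} (hC : C ⊆ IntermediateBV)
    {M : (ℝ → ℝ) → ℝ → ℕ → ℕ} (h : Cp Datum.args (fun (d : Datum 1) k => M d.f (d.x 0) k)) :
    ModulusComputableInE2 C M := by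
  obtain ⟨e, he⟩ := h
  obtain ⟨e', he'⟩ := Red.front (X := Datum 1 × ℕ) (p := fun z => z.1.args) (z := fun z => arg0 z.2)
    (c := fun _ => []) (L := 3) (fun z => by simp [Datum.args]) e
  refine ⟨e', fun f hf Y hY x α hα k => ?_⟩
  let d : Datum 1 := ⟨f, Y, fun _ => x, fun _ => α, hC hf, hY, fun _ => hα⟩
  simpa [Datum.args, d] using he' (d, k) _ (by simpa using he d k)

end Datum

/-! ## One-sided limits and the function classes -/

theorem tendsto_leftLim_of_mem_BV {f : ℝ → ℝ} (hf : f ∈ BV) {x : ℝ} (hx : x ∈ Ioc (0 : ℝ) 1) :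
    Tendsto f (𝓝[<] x) (𝓝 (Function.leftLim f x)) := by
  apply tendsto_leftLim_of_tendsto
  obtain ⟨l, hl⟩ := BoundedVariationOn.exists_tendsto_left hf x
  refine ⟨l, hl.mono_left (nhdsWithin_le_iff.2 ?_)⟩
  filter_upwards [Ioo_mem_nhdsLT hx.1] with y hy
  exact ⟨⟨hy.1.le, hy.2.le.trans hx.2⟩, hy.2⟩

theorem tendsto_rightLim_of_mem_BV {f : ℝ → ℝ} (hf : f ∈ BV) {x : ℝ} (hx : x ∈ Ico (0 : ℝ) 1) :
    Tendsto f (𝓝[>] x) (𝓝 (Function.rightLim f x)) := by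
  apply tendsto_rightLim_of_tendsto
  obtain ⟨l, hl⟩ := BoundedVariationOn.exists_tendsto_right hf x
  refine ⟨l, hl.mono_left (nhdsWithin_le_iff.2 ?_)⟩
  filter_upwards [Ioo_mem_nhdsGT hx.2] with y hy
  exact ⟨⟨hx.1.trans hy.1.le, hy.2.le⟩, hy.1⟩

theorem normalisedBV_subset : NormalisedBV ⊆ IntermediateBV := by
  rintro f ⟨hf, -, hr⟩
  refine ⟨hf, fun x hx => ?_⟩
  rw [rightLim_eq_of_tendsto (hr x ⟨hx.1.le, hx.2⟩)]
  exact ⟨min_le_right _ _, le_max_right _ _⟩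

theorem midpointBV_subset : MidpointBV ⊆ IntermediateBV := by
  rintro f ⟨hf, hm⟩
  refine ⟨hf, fun x hx => ?_⟩
  rw [hm x hx]
  constructor
  · have h₁ := min_le_left (Function.leftLim f x) (Function.rightLim f x)
    have h₂ := min_le_right (Function.leftLim f x) (Function.rightLim f x)
    linarith
  · have h₁ := le_max_left (Function.leftLim f x) (Function.rightLim f x)
    have h₂ := le_max_right (Function.leftLim f x) (Function.rightLim f x)
    linarith

theorem exists_isolating_nhds {f : ℝ → ℝ} (hf : f ∈ BV) {x : ℝ} (hx : x ∈ Ioo (0 : ℝ) 1) {ε : ℝ}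
    (h : ∀ l ∈ ({Function.leftLim f x, Function.rightLim f x} : Set ℝ), ε < |f x - l|) :
    ∃ U : Set ℝ, IsOpen U ∧ x ∈ U ∧ U ⊆ Ioo 0 1 ∧ ∀ y ∈ U, y ≠ x → ε < |f x - f y| := by
  have hl := (tendsto_const_nhds.sub (tendsto_leftLim_of_mem_BV hf ⟨hx.1, hx.2.le⟩)).abs.eventually_const_lt
    (h _ (by simp))
  have hr := (tendsto_const_nhds.sub (tendsto_rightLim_of_mem_BV hf ⟨hx.1.le, hx.2⟩)).abs.eventually_const_lt
    (h _ (by simp))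
  have hlr := eventually_sup.2 ⟨hl, hr⟩
  rw [← nhdsWithin_union, Iio_union_Ioi, eventually_nhdsWithin_iff] at hlr
  obtain ⟨U, hU, hUo, hxU⟩ := eventually_nhds_iff.1 (hlr.and (Ioo_mem_nhds hx.1 hx.2))
  exact ⟨U, hUo, hxU, fun y hy => (hU y hy).2, fun y hy hne => (hU y hy).1 hne⟩

/-- A value outside the interval between the one-sided limits differs from both, so all values at
other points nearby stay away from it. A non-empty open set cannot consist of the one point, which
contradicts quasi-continuity. -/
theorem quasiContinuousBV_subset : QuasiContinuousBV ⊆ IntermediateBV := by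
  rintro f ⟨hf, hq⟩
  refine ⟨hf, fun x hx => ?_⟩
  by_contra hcon
  set l := Function.leftLim f x
  set r := Function.rightLim f x
  have hne : 0 < min |f x - l| |f x - r| := by
    rw [lt_min_iff, abs_pos, abs_pos]
    constructor <;> intro h <;> rw [sub_eq_zero] at h <;> exact hcon (by simp [h])
  obtain ⟨U, hUo, hxU, hU01, hU⟩ := exists_isolating_nhds hf hx (ε := min |f x - l| |f x - r| / 2)
    (by
      rintro _ (rfl | rfl)
      · exact (half_lt_self hne).trans_le (min_le_left _ _)
      · exact (half_lt_self hne).trans_le (min_le_right _ _))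
  obtain ⟨G, hGo, hGU, ⟨y, hyG, hy01⟩, hG⟩ := hq x ⟨hx.1.le, hx.2.le⟩ _ (half_pos hne) U hUo hxU
  obtain ⟨z, hzG, hzx⟩ : ∃ z ∈ G, z ≠ x := by
    by_cases hyx : y = x
    · subst hyx
      obtain ⟨z, hz, hzy⟩ := (eventually_nhdsWithin_of_eventually_nhds (s := {y}ᶜ)
        (hGo.mem_nhds hyG) |>.and self_mem_nhdsWithin).exists
      exact ⟨z, hz, hzy⟩
    · exact ⟨y, hyG, hyx⟩
  have hz01 := hU01 (hGU hzG)
  exact absurd (hU z (hGU hzG) hzx) (not_lt.2 (hG z ⟨hzG, hz01.1.le, hz01.2.le⟩).le)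

/-! ## The variation over dyadic grids -/

/-- The variation of `f` on `[0, x]` over the grid of step `2 ^ (-N)`. -/
noncomputable def gridVariation (f : ℝ → ℝ) (x : ℝ) (N : ℕ) : ℝ :=
  ∑ i ∈ Finset.range (2 ^ N),
    |f (min x (((i + 1 : ℕ) : ℝ) / 2 ^ N)) - f (min x ((i : ℝ) / 2 ^ N))|

theorem gridVariation_le {f : ℝ → ℝ} (hf : f ∈ BV) {x : ℝ} (hx : x ∈ Icc (0 : ℝ) 1) (N : ℕ) :
    gridVariation f x N ≤ (eVariationOn f (Icc 0 1)).toReal := by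
  have hu : Monotone fun i : ℕ => min x ((i : ℝ) / 2 ^ N) := fun i j hij =>
    min_le_min_left _ (by gcongr)
  have h := eVariationOn.sum_le (f := f) (s := Icc 0 1) (n := 2 ^ N) hu
    (fun i => ⟨le_min hx.1 (by positivity), (min_le_left _ _).trans hx.2⟩)
  have h' := ENNReal.toReal_mono hf h
  rw [ENNReal.toReal_sum (fun i _ => edist_ne_top _ _)] at h'
  simpa [gridVariation, edist_dist, Real.dist_eq] using h'

theorem bddAbove_gridVariation {f : ℝ → ℝ} (hf : f ∈ BV) {x : ℝ} (hx : x ∈ Icc (0 : ℝ) 1) :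
    BddAbove (range (gridVariation f x)) :=
  ⟨_, forall_mem_range.2 (gridVariation_le hf hx)⟩

theorem sum_range_two_mul (a : ℕ → ℝ) (n : ℕ) :
    ∑ i ∈ Finset.range (2 * n), a i = ∑ i ∈ Finset.range n, (a (2 * i) + a (2 * i + 1)) := by
  induction n with
  | zero => simp
  | succ n ih => rw [Nat.mul_succ, Finset.sum_range_succ, Finset.sum_range_succ, ih,
      Finset.sum_range_succ]; ring

/-- Passing from `N` to `N + 1` halves every cell, and the triangle inequality applies in each cell.
-/
theorem monotone_gridVariation (f : ℝ → ℝ) (x : ℝ) : Monotone (gridVariation f x) := by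
  refine monotone_nat_of_le_succ fun N => ?_
  rw [gridVariation, gridVariation, pow_succ' 2 N, sum_range_two_mul]
  refine Finset.sum_le_sum fun i _ => ?_
  have e₁ : ((2 * i + 1 + 1 : ℕ) : ℝ) / (2 * 2 ^ N) = ((i + 1 : ℕ) : ℝ) / 2 ^ N := by
    push_cast; field_simp; ring
  have e₂ : ((2 * i : ℕ) : ℝ) / (2 * 2 ^ N) = (i : ℝ) / 2 ^ N := by
    push_cast; field_simp
  rw [pow_succ' (2 : ℝ) N, e₁, e₂]
  have := abs_add_le (f (min x (((i + 1 : ℕ) : ℝ) / 2 ^ N)) - f (min x (((2 * i + 1 : ℕ) : ℝ) / (2 * 2 ^ N))))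
    (f (min x (((2 * i + 1 : ℕ) : ℝ) / (2 * 2 ^ N))) - f (min x ((i : ℝ) / 2 ^ N)))
  rw [sub_add_sub_cancel] at this
  linarith

/-- With `k` the cell of `x`, the two sums agree on the cells to its left. To its right, the terms
for `x` vanish because both nodes are cut off at `x`, and those for `y` telescope under the triangle
inequality. -/
theorem gridVariation_sub_ge (f : ℝ → ℝ) {x y : ℝ} {N k : ℕ} (hy : y ≤ 1)
    (hk : (k : ℝ) / 2 ^ N ≤ x) (hk' : x ≤ ((k + 1 : ℕ) : ℝ) / 2 ^ N)
    (hky : ((k + 1 : ℕ) : ℝ) / 2 ^ N ≤ y) :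
    |f (((k + 1 : ℕ) : ℝ) / 2 ^ N) - f ((k : ℝ) / 2 ^ N)| + |f y - f (((k + 1 : ℕ) : ℝ) / 2 ^ N)| -
      |f x - f ((k : ℝ) / 2 ^ N)| ≤ gridVariation f y N - gridVariation f x N := by
  have hp : (0 : ℝ) < 2 ^ N := by positivity
  have hkN : k + 1 ≤ 2 ^ N := by
    have := hky.trans hy
    rw [div_le_one hp] at this
    exact_mod_cast this
  obtain ⟨r, hr⟩ := Nat.exists_eq_add_of_le hkN
  have hmono : ∀ i j : ℕ, i ≤ j → (i : ℝ) / 2 ^ N ≤ (j : ℝ) / 2 ^ N := fun i j hij => by gcongr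
  have hx : gridVariation f x N = ∑ i ∈ Finset.range k,
      |f (((i + 1 : ℕ) : ℝ) / 2 ^ N) - f ((i : ℝ) / 2 ^ N)| + |f x - f ((k : ℝ) / 2 ^ N)| := by
    rw [gridVariation, hr, Finset.sum_range_add, Finset.sum_range_succ, min_eq_left hk',
      min_eq_right hk, add_eq_left.2 (Finset.sum_eq_zero fun i _ => ?_)]
    · congr 1
      refine Finset.sum_congr rfl fun i hi => ?_
      have hi := Finset.mem_range.1 hi
      rw [min_eq_right ((hmono _ _ hi).trans hk), min_eq_right ((hmono _ _ hi.le).trans hk)]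
    · rw [min_eq_left (hk'.trans (hmono _ _ (by omega))),
        min_eq_left (hk'.trans (hmono _ _ (by omega)))]
      simp
  have hy : ∑ i ∈ Finset.range k, |f (((i + 1 : ℕ) : ℝ) / 2 ^ N) - f ((i : ℝ) / 2 ^ N)| +
      |f (((k + 1 : ℕ) : ℝ) / 2 ^ N) - f ((k : ℝ) / 2 ^ N)| +
      |f y - f (((k + 1 : ℕ) : ℝ) / 2 ^ N)| ≤ gridVariation f y N := by
    rw [gridVariation, hr, Finset.sum_range_add, Finset.sum_range_succ]
    refine add_le_add (add_le_add (Finset.sum_le_sum fun i hi => ?_) ?_) ?_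
    · have hi := Finset.mem_range.1 hi
      rw [min_eq_right ((hmono _ _ (by omega)).trans hky),
        min_eq_right ((hmono _ _ (by omega)).trans hky)]
    · rw [min_eq_right hky, min_eq_right ((hmono _ _ (by omega)).trans hky)]
    · have h₁ := Finset.abs_sum_le_sum_abs (fun i : ℕ =>
        f (min y (((k + 1 + (i + 1) : ℕ) : ℝ) / 2 ^ N)) - f (min y (((k + 1 + i : ℕ) : ℝ) / 2 ^ N)))
        (Finset.range r)
      rw [Finset.sum_range_sub (fun i : ℕ => f (min y (((k + 1 + i : ℕ) : ℝ) / 2 ^ N))), ← hr] at h₁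
      simp only [add_zero, Nat.cast_pow, Nat.cast_ofNat, div_self hp.ne'] at h₁
      rw [min_eq_left ‹y ≤ 1›, min_eq_right hky] at h₁
      simpa only [add_assoc] using h₁
  linarith

/-- The projection of the real line to the unit interval. -/
noncomputable def clamp (x : ℝ) : ℝ := max 0 (min x 1)

theorem clamp_mem (x : ℝ) : clamp x ∈ Icc (0 : ℝ) 1 :=
  ⟨le_max_left _ _, max_le zero_le_one (min_le_right _ _)⟩

theorem clamp_of_mem {x : ℝ} (hx : x ∈ Icc (0 : ℝ) 1) : clamp x = x := by
  rw [clamp, min_eq_left hx.2, max_eq_right hx.1]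

/-- The variation function of `f`, computed from the values on dyadic grids. -/
noncomputable def variation (f : ℝ → ℝ) (x : ℝ) : ℝ := ⨆ N, gridVariation f (clamp x) N

/-- The grid variations increase with `N`, so a bound on all fine grids passes to the suprema. -/
theorem abs_sub_le_variation_sub_of_grid {f : ℝ → ℝ} (hf : f ∈ BV) {x y : ℝ}
    (hx : x ∈ Icc (0 : ℝ) 1) (hy : y ∈ Icc (0 : ℝ) 1)
    (h : ∀ ε > 0, ∀ᶠ N in atTop, |f y - f x| - ε ≤ gridVariation f y N - gridVariation f x N) :
    |f y - f x| ≤ variation f y - variation f x := by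
  rw [variation, variation, clamp_of_mem hx, clamp_of_mem hy, le_sub_iff_add_le]
  refine le_of_forall_pos_le_add fun ε hε => ?_
  obtain ⟨N, hN⟩ := exists_lt_of_lt_ciSup (sub_lt_self (⨆ N, gridVariation f x N) (half_pos hε))
  obtain ⟨M, hM, hNM⟩ := ((h _ (half_pos hε)).and (eventually_ge_atTop N)).exists
  have h₁ := monotone_gridVariation f x hNM
  have h₂ := le_ciSup (bddAbove_gridVariation hf hy) M
  linarith

/-- On a fine grid let [a, c] be the cell of `x`. The values at `a` and `c` are close to the
one-sided limits at `x`, and f(x) lies between these, so |f(c) - f(x)| + |f(x) - f(a)| exceeds |f(c)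
- f(a)| by at most ε. The grid sum for `y`, which does not see `x`, therefore loses at most ε. -/
theorem abs_sub_le_variation_sub {f : ℝ → ℝ} (hf : f ∈ IntermediateBV) {x y : ℝ} (hx : 0 ≤ x)
    (hxy : x ≤ y) (hy : y ≤ 1) : |f y - f x| ≤ variation f y - variation f x := by
  obtain rfl | hlt := hxy.eq_or_lt
  · simp
  refine abs_sub_le_variation_sub_of_grid hf.1 ⟨hx, hxy.trans hy⟩ ⟨hx.trans hxy, hy⟩ fun ε hε => ?_
  have hx1 : x < 1 := hlt.trans_le hy
  obtain ⟨d, hd, hdl, hdr⟩ : ∃ d > 0, (∀ z < x, x - d < z → 0 ≤ z → |f z - Function.leftLim f x| < ε / 4) ∧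
      (∀ z > x, z < x + d → |f z - Function.rightLim f x| < ε / 4) := by
    have h₂ := Metric.tendsto_nhdsWithin_nhds.1
      (tendsto_rightLim_of_mem_BV hf.1 ⟨hx, hx1⟩) (ε / 4) (by positivity)
    obtain ⟨d₂, hd₂, h₂⟩ := h₂
    have hr : ∀ z > x, z < x + d₂ → |f z - Function.rightLim f x| < ε / 4 := fun z hz hz' =>
      h₂ hz (by rw [Real.dist_eq, abs_lt]; constructor <;> linarith)
    obtain rfl | h0 := hx.eq_or_lt
    · exact ⟨d₂, hd₂, fun z hz _ hz0 => absurd hz (not_lt.2 hz0), hr⟩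
    obtain ⟨d₁, hd₁, h₁⟩ := Metric.tendsto_nhdsWithin_nhds.1
      (tendsto_leftLim_of_mem_BV hf.1 ⟨h0, hx1.le⟩) (ε / 4) (by positivity)
    refine ⟨min d₁ d₂, lt_min hd₁ hd₂, fun z hz hz' _ => h₁ hz ?_, fun z hz hz' => hr z hz ?_⟩
    · have := min_le_left d₁ d₂
      rw [Real.dist_eq, abs_lt]; constructor <;> linarith
    · have := min_le_right d₁ d₂
      linarith
  have hsmall : ∀ᶠ N : ℕ in atTop, (1 / 2 : ℝ) ^ N < min d (y - x) :=
    (tendsto_pow_atTop_nhds_zero_of_lt_one (by norm_num) (by norm_num)).eventually_lt_const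
      (lt_min hd (sub_pos.2 hlt))
  filter_upwards [hsmall] with N hN
  have hp : (0 : ℝ) < 2 ^ N := by positivity
  obtain ⟨hNd, hNy⟩ := lt_min_iff.1 hN
  set k := ⌊x * 2 ^ N⌋₊
  have hk : (k : ℝ) / 2 ^ N ≤ x := by
    rw [div_le_iff₀ hp]; exact Nat.floor_le (by positivity)
  have hk' : x < ((k + 1 : ℕ) : ℝ) / 2 ^ N := by
    rw [lt_div_iff₀ hp]; push_cast; exact Nat.lt_floor_add_one _
  have hstep : ((k + 1 : ℕ) : ℝ) / 2 ^ N = (k : ℝ) / 2 ^ N + (1 / 2) ^ N := by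
    push_cast; rw [add_div, one_div_pow]
  have key := gridVariation_sub_ge f hy hk hk'.le (by linarith : ((k + 1 : ℕ) : ℝ) / 2 ^ N ≤ y)
  refine le_trans ?_ key
  set a := (k : ℝ) / 2 ^ N
  set c := ((k + 1 : ℕ) : ℝ) / 2 ^ N
  have hc := abs_lt.1 (hdr c hk' (by linarith))
  have ha0 : 0 ≤ a := by positivity
  -- If `x` is a grid point, no left limit is involved; this covers `x = 0`.
  obtain hax | hax := hk.eq_or_lt
  · rw [hax, sub_self, abs_zero]
    have := abs_sub_le (f y) (f c) (f x)
    linarith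
  · have ha := abs_lt.1 (hdl a hax (by linarith) ha0)
    obtain ⟨h₁, h₂⟩ := hf.2 x ⟨by linarith, hx1⟩
    have h₃ := abs_sub_le (f y) (f c) (f x)
    suffices h : |f c - f x| + |f x - f a| ≤ |f c - f a| + ε by linarith
    rcases le_total (Function.leftLim f x) (Function.rightLim f x) with h | h
    · rw [min_eq_left h] at h₁
      rw [max_eq_right h] at h₂
      have h₄ := le_abs_self (f c - f a)
      rcases abs_cases (f c - f x) with h₅ | h₅ <;> rcases abs_cases (f x - f a) with h₆ | h₆ <;>
        linarith
    · rw [min_eq_right h] at h₁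
      rw [max_eq_left h] at h₂
      have h₄ := neg_abs_le (f c - f a)
      rcases abs_cases (f c - f x) with h₅ | h₅ <;> rcases abs_cases (f x - f a) with h₆ | h₆ <;>
        linarith

theorem monotoneOn_variation {f : ℝ → ℝ} (hf : f ∈ IntermediateBV) :
    MonotoneOn (variation f) (Icc 0 1) := fun _ hx _ hy hxy =>
  sub_nonneg.1 ((abs_nonneg _).trans (abs_sub_le_variation_sub hf hx.1 hxy hy.2))

theorem monotoneOn_variation_sub {f : ℝ → ℝ} (hf : f ∈ IntermediateBV) :
    MonotoneOn (fun x => variation f x - f (clamp x)) (Icc 0 1) := fun x hx y hy hxy => by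
  have := (le_abs_self _).trans (abs_sub_le_variation_sub hf hx.1 hxy hy.2)
  simp only [clamp_of_mem hx, clamp_of_mem hy]
  linarith

/-! ## A point of Hölder continuity -/

/-- The numerators of the left endpoints of a sequence of nested intervals of length `4 ^ (-n)`:
of the two middle quarters of an interval, the one on which `V` increases less is chosen. -/
noncomputable def quarterNode (V : ℝ → ℝ) : ℕ → ℕ
  | 0 => 0
  | n + 1 =>
    open Classical in
    -- With v₁, v₂, v₃ the values of `V` at the three inner division points, the condition is v₂ -
    -- v₁ ≤ v₃ - v₂.
    if V (((4 * quarterNode V n + 2 : ℕ) : ℝ) / 2 ^ (2 * (n + 1))) +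
        V (((4 * quarterNode V n + 2 : ℕ) : ℝ) / 2 ^ (2 * (n + 1))) ≤
        V (((4 * quarterNode V n + 1 : ℕ) : ℝ) / 2 ^ (2 * (n + 1))) +
        V (((4 * quarterNode V n + 3 : ℕ) : ℝ) / 2 ^ (2 * (n + 1)))
      then 4 * quarterNode V n + 1 else 4 * quarterNode V n + 2

/-- The common point of the intervals given by `quarterNode`. -/
noncomputable def quarterPoint (V : ℝ → ℝ) : ℝ := ⨆ n, (quarterNode V n : ℝ) / 2 ^ (2 * n)

section QuarterPoint

variable {V : ℝ → ℝ}

theorem quarterNode_succ_mem (V : ℝ → ℝ) (n : ℕ) :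
    quarterNode V (n + 1) = 4 * quarterNode V n + 1 ∨
      quarterNode V (n + 1) = 4 * quarterNode V n + 2 := by
  rw [quarterNode]
  split_ifs <;> simp

theorem quarterNode_lt (V : ℝ → ℝ) (n : ℕ) : quarterNode V n + 1 ≤ 2 ^ (2 * n) := by
  induction n with
  | zero => simp [quarterNode]
  | succ n ih =>
    rw [show 2 ^ (2 * (n + 1)) = 4 * 2 ^ (2 * n) by rw [mul_add, pow_add]; ring]
    rcases quarterNode_succ_mem V n with h | h <;> omega

theorem two_pow_two_mul_succ (n : ℕ) : (2 : ℝ) ^ (2 * (n + 1)) = 4 * 2 ^ (2 * n) := by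
  rw [mul_add, pow_add]; ring

/-- Choosing a middle quarter leaves a margin of one quarter on each side. The margins bound from
below the distance from the common point to a point outside an interval. -/
theorem quarter_left_step (V : ℝ → ℝ) (n : ℕ) :
    (quarterNode V n : ℝ) / 2 ^ (2 * n) + 1 / 2 ^ (2 * (n + 1)) ≤
      (quarterNode V (n + 1) : ℝ) / 2 ^ (2 * (n + 1)) := by
  have hp : (0 : ℝ) < 2 ^ (2 * n) := by positivity
  have : (4 * quarterNode V n + 1 : ℝ) ≤ quarterNode V (n + 1) := by
    rcases quarterNode_succ_mem V n with h | h <;> rw [h] <;> push_cast <;> linarith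
  rw [two_pow_two_mul_succ, le_div_iff₀ (by positivity), add_mul, div_mul_eq_mul_div,
    div_mul_eq_mul_div, mul_left_comm, mul_div_assoc, mul_div_cancel_right₀ _ (by positivity),
    one_mul, div_self (by positivity)]
  linarith

theorem quarter_right_step (V : ℝ → ℝ) (n : ℕ) :
    ((quarterNode V (n + 1) : ℝ) + 1) / 2 ^ (2 * (n + 1)) ≤
      ((quarterNode V n : ℝ) + 1) / 2 ^ (2 * n) - 1 / 2 ^ (2 * (n + 1)) := by
  have hp : (0 : ℝ) < 2 ^ (2 * n) := by positivity
  have : (quarterNode V (n + 1) : ℝ) + 2 ≤ 4 * (quarterNode V n + 1) := by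
    rcases quarterNode_succ_mem V n with h | h <;> rw [h] <;> push_cast <;> linarith
  rw [le_sub_iff_add_le, ← add_div, two_pow_two_mul_succ, div_le_div_iff₀ (by positivity) hp]
  nlinarith

theorem monotone_quarter_left (V : ℝ → ℝ) :
    Monotone fun n => (quarterNode V n : ℝ) / 2 ^ (2 * n) :=
  monotone_nat_of_le_succ fun n => by
    have := quarter_left_step V n
    have : (0 : ℝ) < 1 / 2 ^ (2 * (n + 1)) := by positivity
    linarith

theorem antitone_quarter_right (V : ℝ → ℝ) :
    Antitone fun n => ((quarterNode V n : ℝ) + 1) / 2 ^ (2 * n) :=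
  antitone_nat_of_succ_le fun n => by
    have := quarter_right_step V n
    have : (0 : ℝ) < 1 / 2 ^ (2 * (n + 1)) := by positivity
    linarith

theorem quarter_left_le_right (V : ℝ → ℝ) (m n : ℕ) :
    (quarterNode V m : ℝ) / 2 ^ (2 * m) ≤ ((quarterNode V n : ℝ) + 1) / 2 ^ (2 * n) := by
  calc (quarterNode V m : ℝ) / 2 ^ (2 * m)
      ≤ (quarterNode V (max m n) : ℝ) / 2 ^ (2 * max m n) :=
        monotone_quarter_left V (le_max_left m n)
    _ ≤ ((quarterNode V (max m n) : ℝ) + 1) / 2 ^ (2 * max m n) := by gcongr; linarith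
    _ ≤ _ := antitone_quarter_right V (le_max_right m n)

theorem bddAbove_quarter_left (V : ℝ → ℝ) :
    BddAbove (range fun n => (quarterNode V n : ℝ) / 2 ^ (2 * n)) :=
  ⟨_, forall_mem_range.2 fun m => quarter_left_le_right V m 0⟩

theorem le_quarterPoint (V : ℝ → ℝ) (n : ℕ) :
    (quarterNode V n : ℝ) / 2 ^ (2 * n) ≤ quarterPoint V :=
  le_ciSup (bddAbove_quarter_left V) n

theorem quarterPoint_le (V : ℝ → ℝ) (n : ℕ) :
    quarterPoint V ≤ ((quarterNode V n : ℝ) + 1) / 2 ^ (2 * n) :=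
  ciSup_le fun m => quarter_left_le_right V m n

theorem quarterPoint_mem (V : ℝ → ℝ) : quarterPoint V ∈ Ioo (0 : ℝ) 1 := by
  have h₁ := quarter_left_step V 0
  have h₂ := quarter_right_step V 0
  have h₃ := le_quarterPoint V 1
  have h₄ := quarterPoint_le V 1
  norm_num [quarterNode] at h₁ h₂ h₃ h₄ ⊢
  constructor <;> linarith

/-- The increases on the two middle quarters add up to at most the whole increase, so the smaller
one is at most half of it. -/
theorem quarter_increment_le (hV : MonotoneOn V (Icc 0 1)) (n : ℕ) :
    V (((quarterNode V n : ℝ) + 1) / 2 ^ (2 * n)) - V ((quarterNode V n : ℝ) / 2 ^ (2 * n)) ≤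
      (V 1 - V 0) / 2 ^ n := by
  induction n with
  | zero => simp [quarterNode]
  | succ n ih =>
    have hp : (0 : ℝ) < 2 ^ (2 * (n + 1)) := by positivity
    have hA := quarterNode_lt V n
    set A := quarterNode V n with hAdef
    have hmem : ∀ j : ℕ, j ≤ 4 → (((4 * A + j : ℕ) : ℝ) / 2 ^ (2 * (n + 1))) ∈ Icc (0 : ℝ) 1 :=
      fun j hj => ⟨by positivity, by
        rw [div_le_one hp, two_pow_two_mul_succ]
        have : 4 * A + j ≤ 4 * 2 ^ (2 * n) := by omega
        exact_mod_cast this⟩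
    have hmono : ∀ i j : ℕ, i ≤ j → j ≤ 4 → V (((4 * A + i : ℕ) : ℝ) / 2 ^ (2 * (n + 1))) ≤
        V (((4 * A + j : ℕ) : ℝ) / 2 ^ (2 * (n + 1))) := fun i j hij hj =>
      hV (hmem i (hij.trans hj)) (hmem j hj) (by gcongr)
    have e₀ : ((4 * A + 0 : ℕ) : ℝ) / 2 ^ (2 * (n + 1)) = (A : ℝ) / 2 ^ (2 * n) := by
      rw [two_pow_two_mul_succ]; push_cast; rw [add_zero, mul_div_mul_left _ _ (by norm_num)]
    have e₄ : ((4 * A + 4 : ℕ) : ℝ) / 2 ^ (2 * (n + 1)) = ((A : ℝ) + 1) / 2 ^ (2 * n) := by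
      rw [two_pow_two_mul_succ]; push_cast
      rw [show (4 * A + 4 : ℝ) = 4 * (A + 1) by ring, mul_div_mul_left _ _ (by norm_num)]
    have h₀₁ := hmono 0 1 (by norm_num) (by norm_num)
    have h₃₄ := hmono 3 4 (by norm_num) (by norm_num)
    rw [e₀] at h₀₁
    rw [e₄] at h₃₄
    rw [pow_succ, ← div_div, le_div_iff₀ (by norm_num : (0 : ℝ) < 2)]
    by_cases hc : V (((4 * A + 2 : ℕ) : ℝ) / 2 ^ (2 * (n + 1))) +
        V (((4 * A + 2 : ℕ) : ℝ) / 2 ^ (2 * (n + 1))) ≤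
        V (((4 * A + 1 : ℕ) : ℝ) / 2 ^ (2 * (n + 1))) +
        V (((4 * A + 3 : ℕ) : ℝ) / 2 ^ (2 * (n + 1)))
    · have hn : quarterNode V (n + 1) = 4 * A + 1 := by rw [quarterNode, if_pos hc]
      rw [hn, ← Nat.cast_succ, show (4 * A + 1).succ = 4 * A + 2 from rfl]
      linarith
    · have hn : quarterNode V (n + 1) = 4 * A + 2 := by rw [quarterNode, if_neg hc]
      rw [hn, ← Nat.cast_succ, show (4 * A + 2).succ = 4 * A + 3 from rfl]
      linarith

end QuarterPoint

/-- The point of continuity that is computed from the variation function of `f`. -/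
noncomputable def regularPoint (f : ℝ → ℝ) : ℝ := quarterPoint (variation f)

theorem regularPoint_mem (f : ℝ → ℝ) : regularPoint f ∈ Ioo (0 : ℝ) 1 := quarterPoint_mem _

/-- Let `I n` be the last of the nested intervals that contains `y`. Then |f(y) - f(x)| is at most
the increase of `V` on `I n`, of order 2^(-n). As `y` is outside `I (n + 1)` and `x` is in `I (n +
2)`, the margin gives |y - x| ≥ 4^(-(n + 2)). The factor 4 is 2^(n + 2) / 2^n. -/
theorem abs_sub_regularPoint_le {f : ℝ → ℝ} (hf : f ∈ IntermediateBV) {y : ℝ}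
    (hy : y ∈ Icc (0 : ℝ) 1) :
    |f y - f (regularPoint f)| ≤
      4 * (variation f 1 - variation f 0) * √|y - regularPoint f| := by
  set V := variation f
  set x := regularPoint f
  obtain rfl | hne := eq_or_ne y x
  · simp
  have hV : MonotoneOn V (Icc 0 1) := monotoneOn_variation hf
  have hW : 0 ≤ V 1 - V 0 := sub_nonneg.2 (hV (by simp) (by simp) zero_le_one)
  let I : ℕ → Set ℝ := fun n =>
    Icc ((quarterNode V n : ℝ) / 2 ^ (2 * n)) (((quarterNode V n : ℝ) + 1) / 2 ^ (2 * n))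
  have hx : ∀ n, x ∈ I n := fun n => ⟨le_quarterPoint V n, quarterPoint_le V n⟩
  have hex : ∃ n, y ∉ I n := by
    obtain ⟨n, hn⟩ := exists_pow_lt_of_lt_one (abs_pos.2 (sub_ne_zero.2 hne))
      (by norm_num : (1 / 4 : ℝ) < 1)
    refine ⟨n, fun hyn => hn.not_ge ?_⟩
    have hlen : ((quarterNode V n : ℝ) + 1) / 2 ^ (2 * n) =
        (quarterNode V n : ℝ) / 2 ^ (2 * n) + (1 / 4) ^ n := by
      rw [add_div, pow_mul, one_div_pow]; norm_num
    have h₁ := hx n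
    simp only [I, mem_Icc, hlen] at h₁ hyn
    rw [abs_le]
    constructor <;> linarith [h₁.1, h₁.2, hyn.1, hyn.2]
  classical
  obtain ⟨n, hn⟩ : ∃ n, Nat.find hex = n + 1 := by
    refine Nat.exists_eq_succ_of_ne_zero fun h0 => Nat.find_spec hex ?_
    rw [h0]
    simpa [I, quarterNode] using hy
  have hyn : y ∈ I n := not_not.1 (Nat.find_min hex (by omega : n < Nat.find hex))
  have hyn' : y ∉ I (n + 1) := hn ▸ Nat.find_spec hex
  have hI : I n ⊆ Icc 0 1 := fun z hz => by
    have hp : (0 : ℝ) < 2 ^ (2 * n) := by positivity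
    refine ⟨le_trans (by positivity) hz.1, hz.2.trans ?_⟩
    rw [div_le_one hp]
    exact_mod_cast quarterNode_lt V n
  have hosc : ∀ u ∈ I n, ∀ v ∈ I n, u ≤ v → |f v - f u| ≤ (V 1 - V 0) / 2 ^ n := by
    intro u hu v hv huv
    refine le_trans ?_ (quarter_increment_le hV n)
    have h₁ := abs_sub_le_variation_sub hf (hI hu).1 huv (hI hv).2
    have hle : (quarterNode V n : ℝ) / 2 ^ (2 * n) ≤ ((quarterNode V n : ℝ) + 1) / 2 ^ (2 * n) :=
      hu.1.trans hu.2
    have h₂ := hV (hI ⟨le_rfl, hle⟩) (hI hu) hu.1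
    have h₃ := hV (hI hv) (hI ⟨hle, le_rfl⟩) hv.2
    linarith
  have hosc' : |f y - f x| ≤ (V 1 - V 0) / 2 ^ n := by
    rcases le_total x y with h | h
    · exact hosc x (hx n) y hyn h
    · rw [abs_sub_comm]
      exact hosc y hyn x (hx n) h
  have hdist : 1 / 2 ^ (2 * (n + 2)) ≤ |y - x| := by
    have h₁ := quarter_left_step V (n + 1)
    have h₂ := quarter_right_step V (n + 1)
    have h₃ := hx (n + 2)
    have h₄ := hyn'
    simp only [I, mem_Icc, not_and_or, not_le] at h₄
    rcases h₄ with h | h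
    · rw [abs_sub_comm]
      refine le_trans ?_ (le_abs_self _)
      linarith [h₃.1]
    · refine le_trans ?_ (le_abs_self _)
      linarith [h₃.2]
  have hsqrt : 1 / 2 ^ (n + 2) ≤ √|y - x| := by
    refine Real.le_sqrt_of_sq_le (le_trans (le_of_eq ?_) hdist)
    rw [div_pow, one_pow, ← pow_mul, mul_comm]
  calc |f y - f x| ≤ (V 1 - V 0) / 2 ^ n := hosc'
    _ = 4 * (V 1 - V 0) * (1 / 2 ^ (n + 2)) := by rw [pow_add]; field_simp; ring
    _ ≤ _ := by gcongr

/-! ## Analysis at a point of Hölder continuity -/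

open MeasureTheory

theorem intervalIntegrable_of_mem {f : ℝ → ℝ} (hf : f ∈ IntermediateBV) :
    IntervalIntegrable f volume 0 1 := by
  have h01 : uIcc (0 : ℝ) 1 = Icc 0 1 := uIcc_of_le zero_le_one
  have h₁ : IntervalIntegrable (variation f) volume 0 1 :=
    MonotoneOn.intervalIntegrable (h01 ▸ monotoneOn_variation hf)
  have h₂ : IntervalIntegrable (fun x => variation f x - f (clamp x)) volume 0 1 :=
    MonotoneOn.intervalIntegrable (h01 ▸ monotoneOn_variation_sub hf)
  refine IntervalIntegrable.congr (fun x hx => ?_) (h₁.sub h₂)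
  rw [uIoc_of_le zero_le_one] at hx
  simp [clamp_of_mem ⟨hx.1.le, hx.2⟩]

section Holder

variable {f : ℝ → ℝ} {x C : ℝ}

theorem continuousWithinAt_of_holder (hC : ∀ y ∈ Icc (0 : ℝ) 1, |f y - f x| ≤ C * √|y - x|) :
    ContinuousWithinAt f (Icc 0 1) x := by
  have h : Tendsto (fun y => C * √|y - x|) (𝓝[Icc 0 1] x) (𝓝 0) := by
    have : Continuous fun y => C * √|y - x| := by fun_prop
    simpa using (this.tendsto x).mono_left (nhdsWithin_le_nhds (s := Icc 0 1))
  refine tendsto_iff_dist_tendsto_zero.2 (squeeze_zero' (Eventually.of_forall fun _ => dist_nonneg)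
    ?_ h)
  filter_upwards [self_mem_nhdsWithin] with y hy using hC y hy

theorem hasDerivAt_integral_of_continuousWithinAt (hf : IntervalIntegrable f volume 0 1)
    (hx : x ∈ Ioo (0 : ℝ) 1) (hc : ContinuousWithinAt f (Icc 0 1) x) :
    HasDerivAt (fun y => ∫ t in (0 : ℝ)..y, f t) (f x) x := by
  have hnhds : Icc (0 : ℝ) 1 ∈ 𝓝 x := Icc_mem_nhds hx.1 hx.2
  refine intervalIntegral.integral_hasDerivAt_right (hf.mono_set ?_) ⟨Ioc 0 1, ?_, ?_⟩
    (hc.continuousAt hnhds)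
  · rw [uIcc_of_le hx.1.le, uIcc_of_le zero_le_one]
    exact Icc_subset_Icc_right hx.2.le
  · exact Ioc_mem_nhds hx.1 hx.2
  · exact hf.1.aestronglyMeasurable

/-- A positive value at a point of continuity would make `f` positive on a non-empty open set, which
has positive measure. -/
theorem eq_zero_of_integral_eq_zero (hf : IntervalIntegrable f volume 0 1)
    (hx : x ∈ Ioo (0 : ℝ) 1) (hc : ContinuousWithinAt f (Icc 0 1) x)
    (h0 : ∀ y ∈ Icc (0 : ℝ) 1, 0 ≤ f y) (hint : ∫ t in (0 : ℝ)..1, f t = 0) : f x = 0 := by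
  by_contra hne
  have hpos : 0 < f x := lt_of_le_of_ne (h0 x ⟨hx.1.le, hx.2.le⟩) (Ne.symm hne)
  have hnhds : Icc (0 : ℝ) 1 ∈ 𝓝 x := Icc_mem_nhds hx.1 hx.2
  obtain ⟨U, hU, hUo, hxU⟩ := eventually_nhds_iff.1
    (((hc.continuousAt hnhds).eventually_const_lt hpos).and (Ioo_mem_nhds hx.1 hx.2))
  have hae : ∀ᵐ y ∂(volume.restrict (Ioc (0 : ℝ) 1)), 0 ≤ f y :=
    (ae_restrict_mem measurableSet_Ioc).mono fun y hy => h0 y ⟨hy.1.le, hy.2⟩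
  have hz := (intervalIntegral.integral_eq_zero_iff_of_le_of_nonneg_ae zero_le_one hae hf).1 hint
  have hz' := (ae_restrict_iff' measurableSet_Ioc).1 hz
  have hnull : volume U = 0 := by
    refine measure_mono_null (fun y hy => ?_) (ae_iff.1 hz')
    have h₁ := hU y hy
    intro h₂
    exact h₁.1.ne' (h₂ ⟨h₁.2.1, h₁.2.2.le⟩)
  exact (hUo.measure_pos volume ⟨x, hxU⟩).ne' hnull

end Holder

/-! ## Dini's criterion for the convergence of Fourier series -/

/-- The function `u ↦ exp (2 π i u)`. -/
noncomputable def expUnit (u : ℝ) : ℂ := Complex.exp (2 * Real.pi * Complex.I * u)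

theorem expUnit_add (u v : ℝ) : expUnit (u + v) = expUnit u * expUnit v := by
  rw [expUnit, expUnit, expUnit, ← Complex.exp_add]
  push_cast
  ring_nf

theorem norm_expUnit (u : ℝ) : ‖expUnit u‖ = 1 := by
  rw [expUnit, show (2 * Real.pi * Complex.I * u : ℂ) = ((2 * Real.pi * u : ℝ) : ℂ) * Complex.I by
    push_cast; ring, Complex.norm_exp_ofReal_mul_I]

theorem continuous_expUnit : Continuous expUnit := by
  unfold expUnit
  fun_prop

/-- The Dirichlet kernel. -/
noncomputable def dirichletKernel (N : ℕ) (u : ℝ) : ℂ :=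
  ∑ n ∈ Finset.Icc (-(N : ℤ)) (N : ℤ), expUnit (n * u)

theorem sum_Icc_neg_succ (F : ℤ → ℂ) (N : ℕ) :
    ∑ n ∈ Finset.Icc (-((N + 1 : ℕ) : ℤ)) ((N + 1 : ℕ) : ℤ), F n =
      F (N + 1) + (F (-(N + 1)) + ∑ n ∈ Finset.Icc (-(N : ℤ)) (N : ℤ), F n) := by
  have h : Finset.Icc (-((N + 1 : ℕ) : ℤ)) ((N + 1 : ℕ) : ℤ) =
      insert ((N : ℤ) + 1) (insert (-((N : ℤ) + 1)) (Finset.Icc (-(N : ℤ)) (N : ℤ))) := by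
    ext n
    simp only [Finset.mem_Icc, Finset.mem_insert]
    omega
  rw [h, Finset.sum_insert, Finset.sum_insert]
  · simp
  · simp only [Finset.mem_Icc, Finset.mem_insert]
    omega

/-- The geometric sum, multiplied out so that it also holds where `expUnit u = 1`. -/
theorem dirichletKernel_mul (N : ℕ) (u : ℝ) :
    dirichletKernel N u * (expUnit u - 1) = expUnit ((N + 1) * u) - expUnit (-(N * u)) := by
  induction N with
  | zero => simp [dirichletKernel, expUnit]
  | succ N ih =>
    rw [dirichletKernel, sum_Icc_neg_succ, ← dirichletKernel, add_mul, add_mul, ih]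
    have h₁ : expUnit (((N + 1 : ℕ) + 1) * u) = expUnit ((N + 1) * u) * expUnit u := by
      rw [← expUnit_add]; push_cast; ring_nf
    have h₂ : expUnit (-(N * u)) = expUnit (-((N + 1 : ℕ) * u)) * expUnit u := by
      rw [← expUnit_add]; push_cast; ring_nf
    rw [h₁, h₂]
    push_cast
    ring_nf

theorem integral_expUnit_mul (n : ℤ) (x : ℝ) :
    ∫ t in (0 : ℝ)..1, expUnit (n * (x - t)) = if n = 0 then 1 else 0 := by
  split_ifs with h
  · simp [h, expUnit]
  · have hc : (-(2 * Real.pi * Complex.I * n) : ℂ) ≠ 0 := by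
      simp [Real.pi_ne_zero, Complex.I_ne_zero, h]
    have e : ∀ t : ℝ, expUnit (n * (x - t)) =
        expUnit (n * x) * Complex.exp (-(2 * Real.pi * Complex.I * n) * t) := fun t => by
      rw [expUnit, expUnit, ← Complex.exp_add]
      push_cast
      ring_nf
    simp_rw [e]
    rw [intervalIntegral.integral_const_mul, integral_exp_mul_complex hc]
    have : Complex.exp (-(2 * Real.pi * Complex.I * n) * (1 : ℝ)) = 1 := by
      rw [show (-(2 * Real.pi * Complex.I * n) * (1 : ℝ) : ℂ) = (-n : ℤ) * (2 * Real.pi * Complex.I) by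
        push_cast; ring]
      exact Complex.exp_int_mul_two_pi_mul_I _
    rw [this]
    simp

theorem intervalIntegrable_ofReal {f : ℝ → ℝ} {a b : ℝ} (hf : IntervalIntegrable f volume a b) :
    IntervalIntegrable (fun t => (f t : ℂ)) volume a b := ⟨hf.1.ofReal, hf.2.ofReal⟩

theorem fourierPartialSum_eq_integral {f : ℝ → ℝ} (hf : IntervalIntegrable f volume 0 1)
    (N : ℕ) (x : ℝ) :
    fourierPartialSum f N x = ∫ t in (0 : ℝ)..1, (f t : ℂ) * dirichletKernel N (x - t) := by
  have hterm : ∀ n : ℤ, fourierCoeffOn (zero_lt_one' ℝ) (fun t => (f t : ℂ)) n *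
      Complex.exp (2 * Real.pi * Complex.I * n * x) =
      ∫ t in (0 : ℝ)..1, (f t : ℂ) * expUnit (n * (x - t)) := fun n => by
    rw [fourierCoeffOn_eq_integral, mul_comm, sub_zero, div_one, one_smul,
      ← intervalIntegral.integral_const_mul]
    refine intervalIntegral.integral_congr fun t _ => ?_
    simp only [fourier_coe_apply, smul_eq_mul, expUnit]
    rw [← mul_assoc, ← Complex.exp_add, mul_comm]
    push_cast
    congr 2
    ring
  rw [fourierPartialSum, Finset.sum_congr rfl fun n _ => hterm n,
    ← intervalIntegral.integral_finsetSum]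
  · simp_rw [dirichletKernel, Finset.mul_sum]
  · intro n _
    refine IntervalIntegrable.mul_continuousOn (intervalIntegrable_ofReal hf) ?_
    exact (continuous_expUnit.comp (by fun_prop)).continuousOn

theorem continuous_dirichletKernel (N : ℕ) : Continuous (dirichletKernel N) :=
  continuous_finsetSum _ fun _ _ => continuous_expUnit.comp (by fun_prop)

theorem integral_dirichletKernel (N : ℕ) (x : ℝ) :
    ∫ t in (0 : ℝ)..1, dirichletKernel N (x - t) = 1 := by
  simp_rw [dirichletKernel]
  rw [intervalIntegral.integral_finsetSum]
  · simp_rw [integral_expUnit_mul]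
    simp
  · intro n _
    exact (continuous_expUnit.comp (by fun_prop)).intervalIntegrable _ _

theorem norm_expUnit_sub_one (u : ℝ) : ‖expUnit u - 1‖ = 2 * |Real.sin (Real.pi * u)| := by
  rw [expUnit, show (2 * Real.pi * Complex.I * u : ℂ) = Complex.I * ((2 * (Real.pi * u) : ℝ) : ℂ) by
    push_cast; ring, Complex.norm_exp_I_mul_ofReal_sub_one]
  rw [mul_div_cancel_left₀ _ (two_ne_zero), Real.norm_eq_abs, abs_mul, abs_two]

/-- Jordan's inequality for the sine, applied to π|u| or to π(1 - |u|). The bound `ρ < 1` keeps `u`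
away from the zeros at ±1, which is why the point of convergence has to be interior. -/
theorem norm_expUnit_sub_one_ge {u ρ : ℝ} (hu : |u| ≤ ρ) (hρ : ρ < 1) :
    4 * (1 - ρ) * |u| ≤ ‖expUnit u - 1‖ := by
  have habs : |Real.sin (Real.pi * u)| = |Real.sin (Real.pi * |u|)| := by
    rcases abs_choice u with h | h <;> rw [h]
    rw [mul_neg, Real.sin_neg, abs_neg]
  rw [norm_expUnit_sub_one, habs]
  have hu0 := abs_nonneg u
  set v := |u|
  have hπ := Real.pi_pos
  have hle : 2 * (1 - ρ) * v ≤ Real.sin (Real.pi * v) := by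
    rcases le_total v (1 / 2) with h | h
    · have := Real.mul_le_sin (x := Real.pi * v) (by positivity) (by nlinarith)
      rw [← mul_assoc, div_mul_cancel₀ _ hπ.ne'] at this
      nlinarith
    · have := Real.mul_le_sin (x := Real.pi * (1 - v)) (by nlinarith) (by nlinarith)
      rw [← mul_assoc, div_mul_cancel₀ _ hπ.ne', mul_one_sub, mul_one_sub, Real.sin_pi_sub] at this
      nlinarith
  have := hle.trans (le_abs_self _)
  linarith

theorem intervalIntegrable_rpow_abs_sub {x : ℝ} (hx : x ∈ Icc (0 : ℝ) 1) :
    IntervalIntegrable (fun t => |t - x| ^ (-(1 / 2) : ℝ)) volume 0 1 := by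
  have hr : (-1 : ℝ) < -(1 / 2) := by norm_num
  have h₁ : IntervalIntegrable (fun t => |t - x| ^ (-(1 / 2) : ℝ)) volume 0 x := by
    have := (intervalIntegral.intervalIntegrable_rpow' hr (a := x) (b := 0)).comp_sub_left x
    simp only [sub_self, sub_zero] at this
    refine IntervalIntegrable.congr (fun t ht => ?_) this
    rw [uIoc_of_le hx.1] at ht
    rw [abs_sub_comm, abs_of_nonneg (sub_nonneg.2 ht.2)]
  have h₂ : IntervalIntegrable (fun t => |t - x| ^ (-(1 / 2) : ℝ)) volume x 1 := by
    have := (intervalIntegral.intervalIntegrable_rpow' hr (a := 0) (b := 1 - x)).comp_sub_right x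
    simp only [zero_add, sub_add_cancel] at this
    refine IntervalIntegrable.congr (fun t ht => ?_) this
    rw [uIoc_of_le hx.2] at ht
    rw [abs_of_nonneg (sub_nonneg.2 ht.1.le)]
  exact h₁.trans h₂

/-- The numerator is at most C |t - x|^(1/2) and the denominator at least a constant times |t - x|,
so the quotient is dominated by a multiple of |t - x|^(-1/2). -/
theorem intervalIntegrable_dini {f : ℝ → ℝ} (hf : IntervalIntegrable f volume 0 1) {x C : ℝ}
    (hx : x ∈ Ioo (0 : ℝ) 1) (hC : ∀ y ∈ Icc (0 : ℝ) 1, |f y - f x| ≤ C * √|y - x|) :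
    IntervalIntegrable (fun t => ((f t : ℂ) - f x) / (expUnit (x - t) - 1)) volume 0 1 := by
  set ρ := max x (1 - x)
  have hρ : ρ < 1 := max_lt hx.2 (by linarith [hx.1])
  have hbound := (intervalIntegrable_rpow_abs_sub ⟨hx.1.le, hx.2.le⟩).const_mul (C / (4 * (1 - ρ)))
  refine hbound.mono_fun ?_ ?_
  · have h₁ : AEStronglyMeasurable (fun t => ((f t : ℂ) - f x))
        (volume.restrict (uIoc (0 : ℝ) 1)) := by
      have := (intervalIntegrable_ofReal hf).aestronglyMeasurable_restrict_uIoc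
      exact this.sub aestronglyMeasurable_const
    have h₂ : Measurable fun t : ℝ => expUnit (x - t) - 1 :=
      ((continuous_expUnit.comp (by fun_prop : Continuous fun t : ℝ => x - t)).sub
        continuous_const).measurable
    exact (h₁.aemeasurable.div h₂.aemeasurable).aestronglyMeasurable
  · rw [uIoc_of_le zero_le_one]
    filter_upwards [ae_restrict_mem measurableSet_Ioc] with t ht
    have ht' : t ∈ Icc (0 : ℝ) 1 := ⟨ht.1.le, ht.2⟩
    have hp : 0 < 4 * (1 - ρ) := by linarith
    refine le_trans ?_ (le_abs_self _)
    -- At `t = x` both sides are 0 by the conventions for division by zero and for powers of zero.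
    obtain rfl | hne := eq_or_ne t x
    · simp only [sub_self, zero_div, norm_zero, abs_zero]
      rw [Real.zero_rpow (by norm_num), mul_zero]
    have hd : 0 < |t - x| := abs_pos.2 (sub_ne_zero.2 hne)
    have hden := norm_expUnit_sub_one_ge (u := x - t) (ρ := ρ) (by
      rw [abs_le]
      have := le_max_left x (1 - x)
      have := le_max_right x (1 - x)
      constructor <;> linarith [ht.1, ht.2]) hρ
    rw [abs_sub_comm] at hden
    rw [norm_div, ← Complex.ofReal_sub, Complex.norm_real, Real.norm_eq_abs]
    have hs : √|t - x| = |t - x| ^ (-(1 / 2) : ℝ) * |t - x| := by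
      rw [Real.sqrt_eq_rpow]
      conv_rhs => rw [← Real.rpow_one |t - x|, ← Real.rpow_mul hd.le, ← Real.rpow_add hd]
      norm_num
    calc |f t - f x| / ‖expUnit (x - t) - 1‖
        ≤ |f t - f x| / (4 * (1 - ρ) * |t - x|) := by gcongr
      _ ≤ (C * √|t - x|) / (4 * (1 - ρ) * |t - x|) := by
        gcongr
        exact hC t ht'
      _ = _ := by rw [hs]; field_simp

-- As the Dirichlet kernel has integral 1, the error is the integral of (f(t) - f(x)) times the
-- kernel. The formula for the kernel turns it into a difference of two terms, each a Fourier
-- integral of the integrable quotient `g`, at frequency N + 1 or -N, times a factor of modulus 1.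
-- Both tend to 0 by the Riemann-Lebesgue lemma.
open FourierTransform in
theorem tendsto_fourierPartialSum {f : ℝ → ℝ} (hf : IntervalIntegrable f volume 0 1) {x C : ℝ}
    (hx : x ∈ Ioo (0 : ℝ) 1) (hC : ∀ y ∈ Icc (0 : ℝ) 1, |f y - f x| ≤ C * √|y - x|) :
    Tendsto (fun N => fourierPartialSum f N x) atTop (𝓝 ((f x : ℝ) : ℂ)) := by
  set g : ℝ → ℂ := fun t => ((f t : ℂ) - f x) / (expUnit (x - t) - 1)
  have hg : IntervalIntegrable g volume 0 1 := intervalIntegrable_dini hf hx hC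
  have hRL : Tendsto (fun w : ℝ => ∫ t in (0 : ℝ)..1, expUnit (-(t * w)) * g t) (cocompact ℝ)
      (𝓝 0) := by
    refine (Real.tendsto_integral_exp_smul_cocompact ((Ioc (0 : ℝ) 1).indicator g)).congr fun w => ?_
    rw [intervalIntegral.integral_of_le zero_le_one, ← integral_indicator measurableSet_Ioc]
    refine integral_congr_ae (Eventually.of_forall fun t => ?_)
    by_cases ht : t ∈ Ioc (0 : ℝ) 1
    · simp only [indicator_of_mem ht, Circle.smul_def, Real.fourierChar_apply, smul_eq_mul, expUnit]
      congr 2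
      push_cast
      ring
    · simp [indicator_of_notMem ht]
  have key : ∀ N : ℕ, fourierPartialSum f N x - f x =
      expUnit ((N + 1) * x) * (∫ t in (0 : ℝ)..1, expUnit (-(t * (N + 1))) * g t) -
        expUnit (-(N * x)) * ∫ t in (0 : ℝ)..1, expUnit (-(t * (-N))) * g t := by
    intro N
    have hcD : Continuous fun t : ℝ => dirichletKernel N (x - t) :=
      (continuous_dirichletKernel N).comp (by fun_prop)
    have h₁ : fourierPartialSum f N x - f x =
        ∫ t in (0 : ℝ)..1, ((f t : ℂ) - f x) * dirichletKernel N (x - t) := by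
      simp_rw [sub_mul]
      rw [intervalIntegral.integral_sub ((intervalIntegrable_ofReal hf).mul_continuousOn hcD.continuousOn)
        ((hcD.const_mul _).intervalIntegrable _ _ : IntervalIntegrable
          (fun t => (f x : ℂ) * dirichletKernel N (x - t)) volume 0 1),
        intervalIntegral.integral_const_mul, integral_dirichletKernel, mul_one,
        fourierPartialSum_eq_integral hf]
    have hi : ∀ w : ℝ, IntervalIntegrable (fun t => expUnit (-(t * w)) * g t) volume 0 1 := fun w =>
      hg.continuousOn_mul (continuous_expUnit.comp (by fun_prop)).continuousOn
    rw [h₁, ← intervalIntegral.integral_const_mul, ← intervalIntegral.integral_const_mul,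
      ← intervalIntegral.integral_sub ((hi _).const_mul _) ((hi _).const_mul _)]
    refine intervalIntegral.integral_congr fun t ht => ?_
    rw [uIcc_of_le zero_le_one] at ht
    -- At `t = x` both sides vanish. Elsewhere the denominator is nonzero because |x - t| < 1.
    have hg' : ((f t : ℂ) - f x) = g t * (expUnit (x - t) - 1) := by
      obtain rfl | hne := eq_or_ne t x
      · simp [g]
      refine (div_mul_cancel₀ _ fun h0 => hne ?_).symm
      have hge := norm_expUnit_sub_one_ge (u := x - t) (ρ := max x (1 - x)) (by
        rw [abs_le]
        have := le_max_left x (1 - x)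
        have := le_max_right x (1 - x)
        constructor <;> linarith [ht.1, ht.2]) (max_lt hx.2 (by linarith [hx.1]))
      have hp : 0 < 1 - max x (1 - x) := sub_pos.2 (max_lt hx.2 (by linarith [hx.1]))
      rw [h0, norm_zero] at hge
      by_contra hxt
      have : 0 < |x - t| := abs_pos.2 (sub_ne_zero.2 (Ne.symm hxt))
      have : 0 < 4 * (1 - max x (1 - x)) * |x - t| := by positivity
      linarith
    rw [hg', mul_assoc, mul_comm (expUnit _ - 1), dirichletKernel_mul, ← mul_assoc, ← mul_assoc,
      ← expUnit_add, ← expUnit_add]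
    ring_nf
  have hN₁ : Tendsto (fun N : ℕ => (N : ℝ) + 1) atTop (cocompact ℝ) :=
    (tendsto_atTop_add_const_right _ 1 tendsto_natCast_atTop_atTop).mono_right atTop_le_cocompact
  have hN₂ : Tendsto (fun N : ℕ => -(N : ℝ)) atTop (cocompact ℝ) :=
    (tendsto_neg_atTop_atBot.comp tendsto_natCast_atTop_atTop).mono_right atBot_le_cocompact
  have hz : ∀ (a : ℕ → ℝ) (w : ℕ → ℂ), Tendsto w atTop (𝓝 0) →
      Tendsto (fun N => expUnit (a N) * w N) atTop (𝓝 0) := fun a w hw => by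
    rw [tendsto_zero_iff_norm_tendsto_zero] at hw ⊢
    simpa [norm_expUnit] using hw
  rw [← tendsto_sub_nhds_zero_iff]
  simp_rw [key]
  simpa using (hz (fun N => (N + 1) * x) _ (hRL.comp hN₁)).sub (hz (fun N => -(N * x)) _ (hRL.comp hN₂))

/-! ## Reduction to the values at dyadic points -/

/-- An enumeration of the dyadic rationals in the unit interval. -/
noncomputable def dyadicPoint (n : ℕ) : ℝ := clamp ((n.unpair.1 : ℝ) / 2 ^ n.unpair.2)

theorem dyadicPoint_mem (n : ℕ) : dyadicPoint n ∈ Icc (0 : ℝ) 1 := clamp_mem _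

theorem exists_dyadicPoint_zero : ∃ n, dyadicPoint n = 0 :=
  ⟨Nat.pair 0 0, by simp [dyadicPoint, clamp]⟩

theorem exists_dyadicPoint_one : ∃ n, dyadicPoint n = 1 :=
  ⟨Nat.pair 1 0, by simp [dyadicPoint, clamp]⟩

theorem exists_dyadicPoint_btwn {u v : ℝ} (hu : 0 ≤ u) (huv : u < v) (hv : v ≤ 1) :
    ∃ n, dyadicPoint n ∈ Ioo u v := by
  obtain ⟨N, hN⟩ := exists_pow_lt_of_lt_one (sub_pos.2 huv) (by norm_num : (1 / 2 : ℝ) < 1)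
  have hp : (0 : ℝ) < 2 ^ N := by positivity
  have h₁ := Nat.floor_le (show 0 ≤ u * 2 ^ N by positivity)
  have h₂ := Nat.lt_floor_add_one (u * 2 ^ N)
  have h₃ : u < ((⌊u * 2 ^ N⌋₊ + 1 : ℕ) : ℝ) / 2 ^ N := by
    rw [lt_div_iff₀ hp]; push_cast; exact h₂
  have h₄ : ((⌊u * 2 ^ N⌋₊ + 1 : ℕ) : ℝ) / 2 ^ N < v := by
    rw [one_div_pow, div_lt_iff₀ hp] at hN
    rw [div_lt_iff₀ hp]; push_cast; linarith
  refine ⟨Nat.pair (⌊u * 2 ^ N⌋₊ + 1) N, ?_⟩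
  rw [dyadicPoint, Nat.unpair_pair, clamp_of_mem ⟨by positivity, h₄.le.trans hv⟩]
  exact ⟨h₃, h₄⟩

/-- A closed interval that contains the values at the dyadic points of an open interval contains
all values on this interval. -/
theorem mem_of_forall_dyadicPoint {f : ℝ → ℝ} (hf : f ∈ IntermediateBV) {S : Set ℝ}
    (hS : IsClosed S) (hS' : S.OrdConnected) {a b y : ℝ}
    (h : ∀ n, dyadicPoint n ∈ Ioo a b → f (dyadicPoint n) ∈ S) (hy : y ∈ Ioo a b)
    (hy01 : y ∈ Icc (0 : ℝ) 1) : f y ∈ S := by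
  -- The class imposes no condition at 0 and 1, but these are dyadic points themselves. At an
  -- interior point both one-sided limits lie in the closed set `S`, hence so does the value between
  -- them.
  obtain rfl | h0 := hy01.1.eq_or_lt
  · obtain ⟨n, hn⟩ := exists_dyadicPoint_zero
    rw [← hn] at hy ⊢
    exact h n hy
  obtain rfl | h1 := hy01.2.eq_or_lt
  · obtain ⟨n, hn⟩ := exists_dyadicPoint_one
    rw [← hn] at hy ⊢
    exact h n hy
  have hl : Function.leftLim f y ∈ S := by
    refine hS.mem_of_frequently_of_tendsto (b := 𝓝[<] y) ?_
      (tendsto_leftLim_of_mem_BV hf.1 ⟨h0, hy01.2⟩)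
    rw [(nhdsLT_basis y).frequently_iff]
    intro u hu
    obtain ⟨n, hn⟩ := exists_dyadicPoint_btwn (u := max u (max a 0)) (v := y) (by simp)
      (max_lt hu (max_lt hy.1 h0)) hy01.2
    simp only [mem_Ioo, max_lt_iff] at hn
    exact ⟨_, ⟨hn.1.1, hn.2⟩, h n ⟨hn.1.2.1, hn.2.trans hy.2⟩⟩
  have hr : Function.rightLim f y ∈ S := by
    refine hS.mem_of_frequently_of_tendsto (b := 𝓝[>] y) ?_
      (tendsto_rightLim_of_mem_BV hf.1 ⟨hy01.1, h1⟩)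
    rw [(nhdsGT_basis y).frequently_iff]
    intro u hu
    obtain ⟨n, hn⟩ := exists_dyadicPoint_btwn (u := y) (v := min u (min b 1)) hy01.1
      (lt_min hu (lt_min hy.2 h1)) (by simp)
    simp only [mem_Ioo, lt_min_iff] at hn
    exact ⟨_, ⟨hn.1, hn.2.1⟩, h n ⟨hy.1.trans hn.1, hn.2.2.1⟩⟩
  exact hS'.uIcc_subset hl hr (hf.2 y ⟨h0, h1⟩)

theorem abs_sub_le_of_forall_dyadicPoint {f : ℝ → ℝ} (hf : f ∈ IntermediateBV) {a b c ε y : ℝ}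
    (h : ∀ n, dyadicPoint n ∈ Ioo a b → |c - f (dyadicPoint n)| ≤ ε) (hy : y ∈ Ioo a b)
    (hy01 : y ∈ Icc (0 : ℝ) 1) : |c - f y| ≤ ε := by
  have h' := mem_of_forall_dyadicPoint hf (isClosed_Icc (a := c - ε) (b := c + ε)) ordConnected_Icc
    (fun n hn => by
      have := abs_le.1 (h n hn)
      constructor <;> linarith) hy hy01
  rw [abs_le]
  constructor <;> linarith [h'.1, h'.2]

theorem abs_sub_le_of_forall_dyadicPoint₂ {f : ℝ → ℝ} (hf : f ∈ IntermediateBV) {a b ε y z : ℝ}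
    (h : ∀ m n, dyadicPoint m ∈ Ioo a b → dyadicPoint n ∈ Ioo a b →
      |f (dyadicPoint m) - f (dyadicPoint n)| ≤ ε)
    (hy : y ∈ Ioo a b) (hy01 : y ∈ Icc (0 : ℝ) 1) (hz : z ∈ Ioo a b) (hz01 : z ∈ Icc (0 : ℝ) 1) :
    |f y - f z| ≤ ε := by
  refine abs_sub_le_of_forall_dyadicPoint hf (fun n hn => ?_) hz hz01
  rw [abs_sub_comm]
  refine abs_sub_le_of_forall_dyadicPoint hf (fun m hm => ?_) hy hy01
  exact h n m hn hm

/-! ## Suprema -/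

/-- The supremum of `f` on `[p, q]`, computed from the end points and the dyadic points. -/
noncomputable def supOn (f : ℝ → ℝ) (p q : ℝ) : ℝ :=
  ⨆ n, f (max (clamp p) (min (clamp q) (dyadicPoint n)))

theorem clip_mem (p q : ℝ) (n : ℕ) :
    max (clamp p) (min (clamp q) (dyadicPoint n)) ∈ Icc (0 : ℝ) 1 :=
  ⟨(clamp_mem p).1.trans (le_max_left _ _),
    max_le (clamp_mem p).2 ((min_le_left _ _).trans (clamp_mem q).2)⟩

theorem bddAbove_clip {f : ℝ → ℝ} (hf : f ∈ BV) (p q : ℝ) :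
    BddAbove (range fun n => f (max (clamp p) (min (clamp q) (dyadicPoint n)))) := by
  refine ⟨f 0 + (eVariationOn f (Icc 0 1)).toReal, forall_mem_range.2 fun n => ?_⟩
  have := BoundedVariationOn.sub_le hf (clip_mem p q n) (show (0 : ℝ) ∈ Icc (0 : ℝ) 1 by simp)
  linarith

theorem isLUB_supOn {f : ℝ → ℝ} (hf : f ∈ IntermediateBV) {p q : ℝ} (hp : p ∈ Icc (0 : ℝ) 1)
    (hq : q ∈ Icc (0 : ℝ) 1) (hpq : p ≤ q) : IsLUB (f '' Icc p q) (supOn f p q) := by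
  have hle : ∀ n, f (max p (min q (dyadicPoint n))) ≤ supOn f p q := fun n => by
    have := le_ciSup (bddAbove_clip hf.1 p q) n
    rwa [← supOn, clamp_of_mem hp, clamp_of_mem hq] at this
  constructor
  · rintro _ ⟨y, hy, rfl⟩
    -- The values at `p` and `q` are not controlled by nearby dyadic points; they enter the supremum
    -- because 0 and 1 are clipped to `p` and `q`.
    obtain rfl | hpy := hy.1.eq_or_lt
    · obtain ⟨n, hn⟩ := exists_dyadicPoint_zero
      simpa [hn, hq.1, hp.1] using hle n
    obtain rfl | hyq := hy.2.eq_or_lt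
    · obtain ⟨n, hn⟩ := exists_dyadicPoint_one
      simpa [hn, hq.2, hpq] using hle n
    refine mem_of_forall_dyadicPoint hf isClosed_Iic ordConnected_Iic (fun n hn => ?_)
      (⟨hpy, hyq⟩ : y ∈ Ioo p q) ⟨hp.1.trans hy.1, hy.2.trans hq.2⟩
    have := hle n
    rwa [min_eq_right hn.2.le, max_eq_right hn.1.le] at this
  · intro c hc
    refine ciSup_le fun n => hc ⟨_, ?_, rfl⟩
    rw [clamp_of_mem hp, clamp_of_mem hq]
    exact ⟨le_max_left _ _, max_le hpq (min_le_left _ _)⟩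

/-! ## Moduli -/

/-- The least exponent that is good enough for all dyadic points. -/
noncomputable def continuityModulus (f : ℝ → ℝ) (x : ℝ) (k : ℕ) : ℕ :=
  sInf {m | ∀ n, |clamp x - dyadicPoint n| < (1 / 2 : ℝ) ^ m →
    |f (clamp x) - f (dyadicPoint n)| ≤ (1 / 2 : ℝ) ^ (k + 1)}

theorem half_pow_succ_lt (k : ℕ) : (1 / 2 : ℝ) ^ (k + 1) < (1 / 2 : ℝ) ^ k :=
  pow_lt_pow_right_of_lt_one₀ (by norm_num) (by norm_num) (Nat.lt_succ_self k)

theorem exists_half_pow_lt {d : ℝ} (hd : 0 < d) : ∃ m : ℕ, (1 / 2 : ℝ) ^ m < d :=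
  exists_pow_lt_of_lt_one hd (by norm_num)

/-- A non-strict bound is a closed condition and so extends from dyadic to all points; the exponent
`k + 1` restores the strict inequality. Continuity at `x` is needed only for the infimum to be
attained. -/
theorem isModulusOfContinuity_continuityModulus {f : ℝ → ℝ} (hf : f ∈ IntermediateBV) :
    IsModulusOfContinuity f (continuityModulus f) := by
  rintro k x ⟨hx, hc⟩ y hy hxy
  have hmem : continuityModulus f x k ∈ {m | ∀ n, |clamp x - dyadicPoint n| < (1 / 2 : ℝ) ^ m →
      |f (clamp x) - f (dyadicPoint n)| ≤ (1 / 2 : ℝ) ^ (k + 1)} := by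
    refine Nat.sInf_mem ?_
    obtain ⟨d, hd, h⟩ := Metric.continuousWithinAt_iff.1 hc ((1 / 2) ^ (k + 1)) (by positivity)
    obtain ⟨m, hm⟩ := exists_half_pow_lt hd
    refine ⟨m, fun n hn => ?_⟩
    rw [clamp_of_mem hx] at hn ⊢
    have := h (dyadicPoint_mem n) (by rw [dist_comm]; exact hn.trans hm)
    rw [dist_comm] at this
    exact this.le
  rw [mem_ofPred_eq, clamp_of_mem hx] at hmem
  refine lt_of_le_of_lt ?_ (half_pow_succ_lt k)
  have hxy' := abs_lt.1 hxy
  refine abs_sub_le_of_forall_dyadicPoint hf (a := x - (1 / 2) ^ continuityModulus f x k)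
    (b := x + (1 / 2) ^ continuityModulus f x k) (fun n hn => hmem n ?_)
    ⟨by linarith, by linarith⟩ hy
  rw [abs_lt]
  constructor <;> linarith [hn.1, hn.2]

/-- At dyadic points at distance less than `2 ^ (-(m + 1))` from `x`, on one side of `x`, the values
of `f` differ by at most `2 ^ (-(k + 1))`. -/
def RegulationBound (f : ℝ → ℝ) (x : ℝ) (k m : ℕ) : Prop :=
  ∀ i j,
    ((x < dyadicPoint i ∧ dyadicPoint i < x + (1 / 2 : ℝ) ^ (m + 1)) →
      (x < dyadicPoint j ∧ dyadicPoint j < x + (1 / 2 : ℝ) ^ (m + 1)) →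
      |f (dyadicPoint i) - f (dyadicPoint j)| ≤ (1 / 2 : ℝ) ^ (k + 1)) ∧
    ((x - (1 / 2 : ℝ) ^ (m + 1) < dyadicPoint i ∧ dyadicPoint i < x) →
      (x - (1 / 2 : ℝ) ^ (m + 1) < dyadicPoint j ∧ dyadicPoint j < x) →
      |f (dyadicPoint i) - f (dyadicPoint j)| ≤ (1 / 2 : ℝ) ^ (k + 1))

/-- The least exponent that satisfies `RegulationBound`. -/
noncomputable def regulationModulus (f : ℝ → ℝ) (x : ℝ) (k : ℕ) : ℕ :=
  sInf {m | RegulationBound f (clamp x) k m}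

theorem exists_oscillation_le {f : ℝ → ℝ} {x l ε : ℝ} {s : Set ℝ}
    (h : Tendsto f (𝓝[s] x) (𝓝 l)) (hε : 0 < ε) :
    ∃ d > 0, ∀ y ∈ s, ∀ z ∈ s, |y - x| < d → |z - x| < d → |f y - f z| ≤ ε := by
  obtain ⟨d, hd, h⟩ := Metric.tendsto_nhdsWithin_nhds.1 h (ε / 2) (half_pos hε)
  refine ⟨d, hd, fun y hy z hz hyd hzd => ?_⟩
  have h₁ := dist_triangle_right (f y) (f z) l
  have h₂ := h hy hyd
  have h₃ := h hz hzd
  rw [← Real.dist_eq]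
  linarith

theorem exists_regulationBound {f : ℝ → ℝ} (hf : f ∈ BV) {x : ℝ} (hx : x ∈ Icc (0 : ℝ) 1)
    (k : ℕ) : ∃ m, RegulationBound f x k m := by
  have hε : (0 : ℝ) < (1 / 2) ^ (k + 1) := by positivity
  obtain ⟨d₁, hd₁, h₁⟩ : ∃ d > 0, ∀ y ∈ Ioi x ∩ Icc 0 1, ∀ z ∈ Ioi x ∩ Icc 0 1,
      |y - x| < d → |z - x| < d → |f y - f z| ≤ (1 / 2 : ℝ) ^ (k + 1) := by
    obtain hx1 | hx1 := hx.2.eq_or_lt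
    · exact ⟨1, one_pos, fun y hy => absurd hy.2.2 (not_le.2 (hx1 ▸ hy.1))⟩
    · obtain ⟨d, hd, h⟩ := exists_oscillation_le (tendsto_rightLim_of_mem_BV hf ⟨hx.1, hx1⟩) hε
      exact ⟨d, hd, fun y hy z hz => h y hy.1 z hz.1⟩
  obtain ⟨d₂, hd₂, h₂⟩ : ∃ d > 0, ∀ y ∈ Iio x ∩ Icc 0 1, ∀ z ∈ Iio x ∩ Icc 0 1,
      |y - x| < d → |z - x| < d → |f y - f z| ≤ (1 / 2 : ℝ) ^ (k + 1) := by
    obtain hx0 | hx0 := hx.1.eq_or_lt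
    · exact ⟨1, one_pos, fun y hy => absurd hy.2.1 (not_le.2 (hx0 ▸ hy.1))⟩
    · obtain ⟨d, hd, h⟩ := exists_oscillation_le (tendsto_leftLim_of_mem_BV hf ⟨hx0, hx.2⟩) hε
      exact ⟨d, hd, fun y hy z hz => h y hy.1 z hz.1⟩
  obtain ⟨m, hm⟩ := exists_half_pow_lt (lt_min hd₁ hd₂)
  have hm' := lt_min_iff.1 ((half_pow_succ_lt m).trans hm)
  refine ⟨m, fun i j => ⟨fun hi hj => h₁ _ ⟨hi.1, dyadicPoint_mem i⟩ _ ⟨hj.1, dyadicPoint_mem j⟩ ?_ ?_,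
    fun hi hj => h₂ _ ⟨hi.2, dyadicPoint_mem i⟩ _ ⟨hj.2, dyadicPoint_mem j⟩ ?_ ?_⟩⟩ <;>
  · rw [abs_lt]
    constructor <;> linarith [hi.1, hi.2, hj.1, hj.2, hm'.1, hm'.2]

/-- `RegulationBound` compares pairs of values and so avoids the one-sided limits, which keeps it
decidable. The limits come in here, by letting one point of the pair tend to `x`. -/
theorem isModulusOfRegulation_regulationModulus {f : ℝ → ℝ} (hf : f ∈ IntermediateBV) :
    IsModulusOfRegulation f (regulationModulus f) := by
  intro k x hx
  have hmem := Nat.sInf_mem (s := {m | RegulationBound f x k m}) (exists_regulationBound hf.1 hx k)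
  have hM : regulationModulus f x k = sInf {m | RegulationBound f x k m} := by
    rw [regulationModulus, clamp_of_mem hx]
  rw [mem_ofPred_eq, ← hM] at hmem
  have h₁ := fun i j => (hmem i j).1
  have h₂ := fun i j => (hmem i j).2
  set r := (1 / 2 : ℝ) ^ (regulationModulus f x k + 1)
  have hr : 0 < r := by positivity
  refine ⟨fun y hy => lt_of_le_of_lt ?_ (half_pow_succ_lt k),
    fun y hy => lt_of_le_of_lt ?_ (half_pow_succ_lt k)⟩
  · have hx1 : x < 1 := hy.1.1.trans_le hy.2.2
    refine le_of_tendsto ((tendsto_rightLim_of_mem_BV hf.1 ⟨hx.1, hx1⟩).sub_const (f y)).abs ?_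
    filter_upwards [Ioo_mem_nhdsGT (lt_add_of_pos_right x hr), Ioo_mem_nhdsGT hx1] with z hz hz1
    exact abs_sub_le_of_forall_dyadicPoint₂ hf h₁ hz ⟨hx.1.trans hz1.1.le, hz1.2.le⟩ hy.1 hy.2
  · have hx0 : 0 < x := hy.2.1.trans_lt hy.1.2
    refine le_of_tendsto ((tendsto_leftLim_of_mem_BV hf.1 ⟨hx0, hx.2⟩).sub_const (f y)).abs ?_
    filter_upwards [Ioo_mem_nhdsLT (sub_lt_self x hr), Ioo_mem_nhdsLT hx0] with z hz hz0
    exact abs_sub_le_of_forall_dyadicPoint₂ hf h₂ hz ⟨hz0.1.le, hz0.2.le.trans hx.2⟩ hy.1 hy.2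

/-! ## Computability of the functionals -/

section Computability

variable {m : ℕ} {σ : Type*} [Primcodable σ]

theorem Datum.cr_clamp {U : Datum m → σ → ℝ} (hU : CR Datum.args U) :
    CR Datum.args (fun d s => clamp (U d s)) :=
  (CR.nat (Cp.const 0)).max (hU.min (CR.nat (Cp.const 1))) |>.of_eq fun d s => by simp [clamp]

theorem Datum.cr_variation {U : Datum m → σ → ℝ} (hU : CR Datum.args U) :
    CR Datum.args (fun d s => variation d.f (U d s)) := by
  have hpt : CR Datum.args (fun (d : Datum m) (q : (σ × ℕ) × ℕ) =>
      d.f (min (clamp (U d q.1.1)) ((q.2 : ℝ) / 2 ^ q.1.2))) :=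
    Datum.cr_apply (((Datum.cr_clamp hU).comp Cp.id.fst.fst).min (CR.dyadic Cp.id.snd Cp.id.fst.snd))
      fun d q => ⟨le_min (clamp_mem _).1 (by positivity), (min_le_left _ _).trans (clamp_mem _).2⟩
  have hpt' : CR Datum.args (fun (d : Datum m) (q : (σ × ℕ) × ℕ) =>
      d.f (min (clamp (U d q.1.1)) (((q.2 + 1 : ℕ) : ℝ) / 2 ^ q.1.2))) :=
    hpt.comp (G := fun _ (q : (σ × ℕ) × ℕ) => (q.1, q.2 + 1))
      (Cp.id.fst.pair (Cp.id.snd.add (Cp.const 1)))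
  have hsum : CR Datum.args (fun (d : Datum m) (p : σ × ℕ) =>
      gridVariation d.f (clamp (U d p.1)) p.2) :=
    CR.sum (R := fun (d : Datum m) (p : σ × ℕ) i =>
      |d.f (min (clamp (U d p.1)) (((i + 1 : ℕ) : ℝ) / 2 ^ p.2)) -
        d.f (min (clamp (U d p.1)) ((i : ℝ) / 2 ^ p.2))|) (K := fun _ p => 2 ^ p.2)
      (hpt'.sub hpt).abs Cp.id.snd.two_pow fun _ _ _ => abs_nonneg _
  have hsup := CR.iSup (R := fun (d : Datum m) (s : σ) N => gridVariation d.f (clamp (U d s)) N) hsum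
    fun d s => bddAbove_gridVariation d.mem.1 (clamp_mem _)
  exact hsup.of_eq fun _ _ => rfl

theorem Datum.cp_quarterNode :
    Cp Datum.args (fun (d : Datum m) (n : ℕ) => quarterNode (variation d.f) n) := by
  classical
  have hV : ∀ j : ℕ, CR Datum.args (fun (d : Datum m) (q : Unit × ℕ × ℕ) =>
      variation d.f (((4 * q.2.2 + j : ℕ) : ℝ) / 2 ^ (2 * (q.2.1 + 1)))) := fun j =>
    Datum.cr_variation (CR.dyadic (((Cp.const 4).mul Cp.id.snd.snd).add (Cp.const j))
      ((Cp.const 2).mul (Cp.id.snd.fst.add (Cp.const 1))))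
  -- ∃² decides this comparison of reals exactly, so the choice of a quarter depends on `f` only and
  -- not on its code.
  have hstep := Dec.ite (((hV 2).add (hV 2)).le ((hV 1).add (hV 3)))
    (((Cp.const 4).mul (Cp.id (σ := Unit × ℕ × ℕ)).snd.snd).add (Cp.const 1))
    (((Cp.const 4).mul Cp.id.snd.snd).add (Cp.const 2))
  have hrec := Cp.prec (F := fun (_ : Datum m) (_ : Unit) => 0) (Cp.const 0) hstep
  refine (hrec.comp ((Cp.const ()).pair Cp.id)).of_eq fun d n => ?_
  induction n with
  | zero => rfl
  | succ n ih =>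
    simp only at ih ⊢
    rw [ih, quarterNode]

theorem Datum.cr_regularPoint :
    CR Datum.args (fun (d : Datum m) (_ : σ) => regularPoint d.f) :=
  CR.iSup (R := fun (d : Datum m) (_ : σ) n => (quarterNode (variation d.f) n : ℝ) / 2 ^ (2 * n))
    (CR.dyadic (Datum.cp_quarterNode.comp Cp.id.snd) ((Cp.const 2).mul Cp.id.snd))
    fun _ _ => bddAbove_quarter_left _

theorem Datum.cr_dyadicPoint {i : Datum m → σ → ℕ} (hi : Cp Datum.args i) :
    CR Datum.args (fun d s => dyadicPoint (i d s)) :=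
  Datum.cr_clamp (CR.dyadic hi.num hi.unpair_snd)

theorem Datum.cr_apply_dyadicPoint {i : Datum m → σ → ℕ} (hi : Cp Datum.args i) :
    CR Datum.args (fun d s => d.f (dyadicPoint (i d s))) :=
  Datum.cr_apply (Datum.cr_dyadicPoint hi) fun _ _ => dyadicPoint_mem _

theorem Datum.cr_apply_clamp {U : Datum m → σ → ℝ} (hU : CR Datum.args U) :
    CR Datum.args (fun d s => d.f (clamp (U d s))) :=
  Datum.cr_apply (Datum.cr_clamp hU) fun _ _ => clamp_mem _

theorem Datum.cr_supOn :
    CR Datum.args (fun (d : Datum 2) (_ : Unit) => supOn d.f (d.x 0) (d.x 1)) :=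
  CR.iSup (R := fun (d : Datum 2) (_ : Unit) n =>
      d.f (max (clamp (d.x 0)) (min (clamp (d.x 1)) (dyadicPoint n))))
    (Datum.cr_apply ((Datum.cr_clamp (Datum.cr_param 0)).max
      ((Datum.cr_clamp (Datum.cr_param 1)).min (Datum.cr_dyadicPoint Cp.id.snd)))
      fun _ _ => clip_mem _ _ _) fun d _ => bddAbove_clip d.mem.1 _ _

theorem Datum.cp_continuityModulus :
    Cp Datum.args (fun (d : Datum 1) k => continuityModulus d.f (d.x 0) k) := by
  refine Dec.sInf (P := fun (d : Datum 1) k r => ∀ n,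
    |clamp (d.x 0) - dyadicPoint n| < (1 / 2 : ℝ) ^ r →
      |d.f (clamp (d.x 0)) - d.f (dyadicPoint n)| ≤ (1 / 2 : ℝ) ^ (k + 1)) (Dec.all ?_)
  exact ((((Datum.cr_clamp (Datum.cr_param 0)).sub (Datum.cr_dyadicPoint Cp.id.snd)).abs.lt
    (CR.half_pow Cp.id.fst.snd)).imp
    (((Datum.cr_apply_clamp (Datum.cr_param 0)).sub (Datum.cr_apply_dyadicPoint Cp.id.snd)).abs.le
      (CR.half_pow (Cp.id.fst.fst.add (Cp.const 1)))))

theorem Datum.cp_regulationModulus :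
    Cp Datum.args (fun (d : Datum 1) k => regulationModulus d.f (d.x 0) k) := by
  have hx : CR Datum.args (fun (d : Datum 1) (_ : ((ℕ × ℕ) × ℕ) × ℕ) => clamp (d.x 0)) :=
    Datum.cr_clamp (Datum.cr_param 0)
  have hr : CR Datum.args (fun (_ : Datum 1) (q : ((ℕ × ℕ) × ℕ) × ℕ) =>
      (1 / 2 : ℝ) ^ (q.1.1.2 + 1)) := CR.half_pow (Cp.id.fst.fst.snd.add (Cp.const 1))
  have hk : CR Datum.args (fun (_ : Datum 1) (q : ((ℕ × ℕ) × ℕ) × ℕ) =>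
      (1 / 2 : ℝ) ^ (q.1.1.1 + 1)) := CR.half_pow (Cp.id.fst.fst.fst.add (Cp.const 1))
  have hi : CR Datum.args (fun (_ : Datum 1) (q : ((ℕ × ℕ) × ℕ) × ℕ) => dyadicPoint q.1.2) :=
    Datum.cr_dyadicPoint Cp.id.fst.snd
  have hj : CR Datum.args (fun (_ : Datum 1) (q : ((ℕ × ℕ) × ℕ) × ℕ) => dyadicPoint q.2) :=
    Datum.cr_dyadicPoint Cp.id.snd
  have hf := (((Datum.cr_apply_dyadicPoint (m := 1) (Cp.id (σ := ((ℕ × ℕ) × ℕ) × ℕ)).fst.snd).sub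
    (Datum.cr_apply_dyadicPoint Cp.id.snd)).abs.le hk)
  have h := (((hx.lt hi).and (hi.lt (hx.add hr))).imp (((hx.lt hj).and (hj.lt (hx.add hr))).imp hf)).and
    ((((hx.sub hr).lt hi).and (hi.lt hx)).imp ((((hx.sub hr).lt hj).and (hj.lt hx)).imp hf))
  exact Dec.sInf (P := fun (d : Datum 1) k r => RegulationBound d.f (clamp (d.x 0)) k r)
    (Dec.all (Dec.all h))

theorem realComputableInE2_regularPoint {C : Set (ℝ → ℝ)} (hC : C ⊆ IntermediateBV) :
    RealComputableInE2 C 0 (fun f _ => regularPoint f) :=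
  realComputableInE2_of_cr hC Datum.cr_regularPoint

end Computability

theorem continuousWithinAt_regularPoint {f : ℝ → ℝ} (hf : f ∈ IntermediateBV) :
    ContinuousWithinAt f (Icc 0 1) (regularPoint f) :=
  continuousWithinAt_of_holder fun _ hy => abs_sub_regularPoint_le hf hy

end Kleene

/-! ### Assembly of the functionals. -/

theorem theorem2p25 :
    (∀ C : Set (ℝ → ℝ),
      (C = Kleene.NormalisedBV ∨ C = Kleene.QuasiContinuousBV ∨
        C = Kleene.IntermediateBV ∨ C = Kleene.MidpointBV) →
      -- suprema
      (∃ Φ : (ℝ → ℝ) → ℝ → ℝ → ℝ,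
        (∀ f ∈ C, ∀ p ∈ Set.Icc (0 : ℝ) 1, ∀ q ∈ Set.Icc (0 : ℝ) 1, p ≤ q →
          IsLUB (f '' Set.Icc p q) (Φ f p q)) ∧
        Kleene.RealComputableInE2 C 2 (fun f v => Φ f (v 0) (v 1))) ∧
      -- Jordan decomposition
      (∃ G H : (ℝ → ℝ) → ℝ → ℝ,
        (∀ f ∈ C, (∀ x ∈ Set.Icc (0 : ℝ) 1, f x = G f x - H f x) ∧
          MonotoneOn (G f) (Set.Icc 0 1) ∧ MonotoneOn (H f) (Set.Icc 0 1)) ∧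
        Kleene.RealComputableInE2 C 1 (fun f v => G f (v 0)) ∧
        Kleene.RealComputableInE2 C 1 (fun f v => H f (v 0))) ∧
      -- a point of continuity
      (∃ Ξ : (ℝ → ℝ) → ℝ,
        (∀ f ∈ C, Kleene.ContinuityPoint f (Ξ f)) ∧
        Kleene.RealComputableInE2 C 0 (fun f _ => Ξ f)) ∧
      -- a point where the Fourier series converges to the function value
      (∃ κ : (ℝ → ℝ) → ℝ,
        (∀ f ∈ C, κ f ∈ Set.Icc (0 : ℝ) 1 ∧
          Filter.Tendsto (fun N => Kleene.fourierPartialSum f N (κ f)) Filter.atTop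
            (nhds ((f (κ f) : ℝ) : ℂ))) ∧
        Kleene.RealComputableInE2 C 0 (fun f _ => κ f)) ∧
      -- a zero of a nonnegative function with integral zero
      (∃ ζ : (ℝ → ℝ) → ℝ,
        (∀ f ∈ C, (∀ x ∈ Set.Icc (0 : ℝ) 1, 0 ≤ f x) → ∫ x in (0 : ℝ)..1, f x = 0 →
          ζ f ∈ Set.Icc (0 : ℝ) 1 ∧ f (ζ f) = 0) ∧
        Kleene.RealComputableInE2
          {f | f ∈ C ∧ (∀ x ∈ Set.Icc (0 : ℝ) 1, 0 ≤ f x) ∧ ∫ x in (0 : ℝ)..1, f x = 0}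
          0 (fun f _ => ζ f)) ∧
      -- a point where the fundamental theorem of calculus holds
      (∃ ε : (ℝ → ℝ) → ℝ,
        (∀ f ∈ C, ε f ∈ Set.Ioo (0 : ℝ) 1 ∧
          HasDerivAt (fun x => ∫ t in (0 : ℝ)..x, f t) (f (ε f)) (ε f)) ∧
        Kleene.RealComputableInE2 C 0 (fun f _ => ε f)) ∧
      -- a modulus of continuity
      (∃ M : (ℝ → ℝ) → ℝ → ℕ → ℕ,
        (∀ f ∈ C, Kleene.IsModulusOfContinuity f (M f)) ∧
        Kleene.ModulusComputableInE2 C M) ∧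
      -- a modulus of regulation
      (∃ M : (ℝ → ℝ) → ℝ → ℕ → ℕ,
        (∀ f ∈ C, Kleene.IsModulusOfRegulation f (M f)) ∧
        Kleene.ModulusComputableInE2 C M)) ∧
    -- for normalised functions, a zero is found without the sign condition
    (∃ ζ : (ℝ → ℝ) → ℝ,
      (∀ f ∈ Kleene.NormalisedBV, ∫ x in (0 : ℝ)..1, f x = 0 →
        ζ f ∈ Set.Icc (0 : ℝ) 1 ∧ f (ζ f) = 0) ∧
      Kleene.RealComputableInE2
        {f | f ∈ Kleene.NormalisedBV ∧ ∫ x in (0 : ℝ)..1, f x = 0}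
        0 (fun f _ => ζ f)) := by
  -- A normalised function vanishes at 0, so the constant 0 serves as the zero without the sign
  -- condition.
  refine ⟨fun C hC => ?_, fun _ => 0, fun f hf _ => ⟨by simp, hf.2.1⟩,
    Kleene.realComputableInE2_of_cr (fun f hf => Kleene.normalisedBV_subset hf.1)
      ((Kleene.CR.nat (Kleene.Cp.const 0)).of_eq fun _ _ => Nat.cast_zero)⟩
  have hsub : C ⊆ Kleene.IntermediateBV := by
    rcases hC with rfl | rfl | rfl | rfl
    · exact Kleene.normalisedBV_subset
    · exact Kleene.quasiContinuousBV_subset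
    · exact subset_rfl
    · exact Kleene.midpointBV_subset
  have hpt := fun f => Kleene.regularPoint_mem f
  have hpt' := fun f => Ioo_subset_Icc_self (hpt f)
  refine ⟨⟨Kleene.supOn, fun f hf p hp q hq hpq => Kleene.isLUB_supOn (hsub hf) hp hq hpq,
      Kleene.realComputableInE2_of_cr hsub Kleene.Datum.cr_supOn⟩,
    ⟨Kleene.variation, fun f x => Kleene.variation f x - f (Kleene.clamp x), fun f hf =>
      ⟨fun x hx => by simp [Kleene.clamp_of_mem hx], Kleene.monotoneOn_variation (hsub hf),
        Kleene.monotoneOn_variation_sub (hsub hf)⟩,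
      Kleene.realComputableInE2_of_cr hsub (Kleene.Datum.cr_variation (Kleene.Datum.cr_param 0)),
      Kleene.realComputableInE2_of_cr hsub ((Kleene.Datum.cr_variation (Kleene.Datum.cr_param 0)).sub
        (Kleene.Datum.cr_apply_clamp (Kleene.Datum.cr_param 0)))⟩,
    ⟨Kleene.regularPoint, fun f hf => ⟨hpt' f, Kleene.continuousWithinAt_regularPoint (hsub hf)⟩,
      Kleene.realComputableInE2_regularPoint hsub⟩,
    ⟨Kleene.regularPoint, fun f hf => ⟨hpt' f,
      Kleene.tendsto_fourierPartialSum (Kleene.intervalIntegrable_of_mem (hsub hf)) (hpt f)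
        fun _ hy => Kleene.abs_sub_regularPoint_le (hsub hf) hy⟩,
      Kleene.realComputableInE2_regularPoint hsub⟩,
    ⟨Kleene.regularPoint, fun f hf h0 hint => ⟨hpt' f,
      Kleene.eq_zero_of_integral_eq_zero (Kleene.intervalIntegrable_of_mem (hsub hf)) (hpt f)
        (Kleene.continuousWithinAt_regularPoint (hsub hf)) h0 hint⟩,
      Kleene.realComputableInE2_regularPoint fun f hf => hsub hf.1⟩,
    ⟨Kleene.regularPoint, fun f hf => ⟨hpt f,
      Kleene.hasDerivAt_integral_of_continuousWithinAt
        (Kleene.intervalIntegrable_of_mem (hsub hf)) (hpt f)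
        (Kleene.continuousWithinAt_regularPoint (hsub hf))⟩,
      Kleene.realComputableInE2_regularPoint hsub⟩,
    ⟨Kleene.continuityModulus, fun f hf => Kleene.isModulusOfContinuity_continuityModulus (hsub hf),
      Kleene.modulusComputableInE2_of_cp hsub Kleene.Datum.cp_continuityModulus⟩,
    ⟨Kleene.regulationModulus, fun f hf => Kleene.isModulusOfRegulation_regulationModulus (hsub hf),
      Kleene.modulusComputableInE2_of_cp hsub Kleene.Datum.cp_regulationModulus⟩⟩
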